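/- **SWAP soundness.** Let $\lambda$ be the security parameter and $D=2^{\lambda}$. A function of $\lambda$ is *negligible* if it is $o(\lambda^{-k})$ for every $k$. *Device.* A unitary qPUF is given by a probability distribution, for each $\lambda$, of a unitary $U$ on $\mathcal H^D$. A *QPT adversary* is a (non-uniform) family of quantum algorithms with polynomially many qubits, elementary gates (Hadamard, $T$, CNOT) and queries to $U$: her work qubits start in a state (quantum advice) that does not depend on $U$; she first runs a circuit with queries to $U$; afterwards, without access to $U$, she receives challenge registers, runs a circuit, and sends these registers back. The qPUF is *selectively unforgeable* if for every QPT adversary, whose state $\sigma$ is her reply to one Haar random pure challenge $|\phi\rangle\in\mathcal H^D$, and every $c\in\mathbb N$, the probability over $U$ and $\phi$ that $F(\sigma,U|\phi\rangle)\ge(\lambda+1)^{-c}$ is negligible. Here $F(\sigma,|\psi\rangle)=\sqrt{\langle\psi|\sigma|\psi\rangle}$. *Protocol (hrv-id-swap).* Let $N=N(\lambda)$ and $M=M(\lambda)$ be bounded by polynomials in $\lambda$. The verifier draws $N$ independent Haar random challenges $|\phi_1\rangle,\dots,|\phi_N\rangle$ and stores $M$ copies of each response $|\psi_i\rangle=U|\phi_i\rangle$.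 She sends each $|\phi_i\rangle$ in $M$ rounds $(i,1),\dots,(i,M)$. She runs, in each round $(i,j)$, the SWAP test on the state received in that round and a copy of $|\psi_i\rangle$, and accepts if all $NM$ tests accept. A QPT adversary Eve replies with an arbitrary, possibly entangled, joint state of the $NM$ registers, computed from all challenge copies and from what she learned by her earlier queries to $U$. For given $U,\phi_1,\dots,\phi_N$ let $\rho_{i,j}$ be the reduced state of round $(i,j)$ and $F_i=\max_{j}F(\rho_{i,j},|\psi_i\rangle)$. **Theorem.** If the unitary qPUF is selectively unforgeable, then for every QPT Eve as above there is a negligible $\nu$ such that for all $\lambda$ $$\Pr[\text{Ver accept}_{\text{Eve}}]\le \mathbb E\Big[\prod_{i=1}^{N}\Big(\tfrac12+\tfrac12F_i^2\Big)^{M}\Big]+\nu(\lambda),\qquad \mathbb E\Big[\prod_{i=1}^{N}\Big(\tfrac12+\tfrac12F_i^2\Big)^{M}\Big]\le 2^{-NM}+\nu(\lambda),$$ where the expectations are over $U$ and the challenges. Moreover: 1. If $2^{NM}$ is bounded by a polynomial in $\lambda$ (for example, if $N$ and $M$ are constant), then $\Pr[\text{Ver accept}_{\text{Eve}}]=O(2^{-NM})$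 as $\lambda\to\infty$, and there is a negligible $\delta$ with $\Pr[\text{Ver accept}_{\text{Eve}}]\le\prod_{i=1}^{N}\big(\tfrac12+\tfrac12\delta(\lambda)\big)^{M}$ for all $\lambda$. 2. If $2^{-NM}$ is negligible, then $\Pr[\text{Ver accept}_{\text{Eve}}]$ is negligible. 3. For all $\lambda$, $U$ and $\phi_1,\dots,\phi_N$ for which Eve's joint reply is a tensor product of states of the single rounds, her probability to be accepted, given $U,\phi_1,\dots,\phi_N$, is at most $\prod_{i=1}^{N}\big(\tfrac12+\tfrac12F_i^2\big)^{M}$. -/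

import Mathlib

open MeasureTheory
open scoped Matrix Kronecker ComplexOrder

namespace SwapId

/-! ### Asymptotic notions -/

/-- Bounded by a polynomial in the security parameter. -/
def PolyBounded (f : ℕ → ℕ) : Prop := ∃ p : Polynomial ℕ, ∀ l, f l ≤ p.eval l

/-- Negligible: smaller than every inverse polynomial, i.e. `l ^ k * f l → 0` for all `k`. -/
def Negligible (f : ℕ → ℝ) : Prop :=
  Asymptotics.SuperpolynomialDecay Filter.atTop (fun l : ℕ => (l : ℝ)) f

/-! ### Quantum circuits on a finite set of qubit wires -/

/-- Bit strings of length `l`: the computational basis of the space of dimension `D = 2 ^ l`. -/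
abbrev Str (l : ℕ) : Type := Fin l → Bool

/-- The matrix `A`, acting on the qubits `e 0, e 1, …` (distinct wires) of a register with wire
set `W`, tensored with the identity on all the other wires. -/
noncomputable def onWires {W : Type} {k : ℕ} (e : Fin k ↪ W)
    (A : Matrix (Fin k → Bool) (Fin k → Bool) ℂ) : Matrix (W → Bool) (W → Bool) ℂ :=
  open Classical in
  Matrix.of fun x y =>
    if ∀ w, w ∉ Set.range e → x w = y w then A (fun i => x (e i)) (fun i => y (e i)) else 0

/-- Entries of the Hadamard gate. -/
noncomputable def hadamardBit : Matrix Bool Bool ℂ :=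
  Matrix.of fun a b => (if a && b then -1 else 1) / (Real.sqrt 2 : ℂ)

/-- Elementary gates, from the universal set Hadamard, `T = diag (1, exp (i π / 4))`, CNOT. -/
inductive Gate (W : Type) : Type
  | hadamard (w : Fin 1 ↪ W)
  | phaseT (w : Fin 1 ↪ W)
  | cnot (w : Fin 2 ↪ W)

/-- The unitary matrix of an elementary gate (wire `w 0` controls and `w 1` is the target). -/
noncomputable def Gate.matrix {W : Type} : Gate W → Matrix (W → Bool) (W → Bool) ℂ
  | .hadamard w => onWires w (Matrix.of fun x y => hadamardBit (x 0) (y 0))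
  | .phaseT w => onWires w (Matrix.diagonal fun x =>
      if x 0 then Complex.exp (Complex.I * (Real.pi / 4 : ℝ)) else 1)
  | .cnot w => onWires w (Matrix.of fun x y =>
      if x 0 = y 0 ∧ x 1 = xor (y 0) (y 1) then 1 else 0)

/-- A step of the learning phase: an elementary gate, or a query of the device, which is applied
to `l` wires of the adversary's choice. -/
inductive LearnStep (l : ℕ) (W : Type) : Type
  | gate (g : Gate W)
  | query (e : Fin l ↪ W)

/-- The matrix of a learning step, when the device is the unitary `U`. -/
noncomputable def LearnStep.matrix {l : ℕ} {W : Type} (U : Matrix.unitaryGroup (Str l) ℂ) :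
    LearnStep l W → Matrix (W → Bool) (W → Bool) ℂ
  | .gate g => g.matrix
  | .query e => onWires e U.1

/-! ### Devices, challenges, responses -/

noncomputable instance instMeasurableSpaceUnitary (l : ℕ) :
    MeasurableSpace (Matrix.unitaryGroup (Str l) ℂ) := borel _

instance instBorelSpaceUnitary (l : ℕ) : BorelSpace (Matrix.unitaryGroup (Str l) ℂ) := ⟨rfl⟩

/-- A unitary qPUF: the manufacturing process draws, for every security parameter `l`, a unitary
on the space of dimension `D = 2 ^ l`. -/
structure UnitaryQPUF where
  law : ∀ l, Measure (Matrix.unitaryGroup (Str l) ℂ)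
  isProb : ∀ l, IsProbabilityMeasure (law l)

/-- Pure states (unit vectors) of the space of dimension `D = 2 ^ l`. -/
abbrev PureState (l : ℕ) : Type := Metric.sphere (0 : EuclideanSpace ℂ (Str l)) 1

/-- The Haar (uniform) distribution of pure states: normalized surface measure of the sphere. -/
noncomputable def haarState (l : ℕ) : Measure (PureState l) :=
  ((volume : Measure (EuclideanSpace ℂ (Str l))).toSphere Set.univ)⁻¹ •
    (volume : Measure (EuclideanSpace ℂ (Str l))).toSphere

instance instIsProbabilityMeasureHaarState (l : ℕ) : IsProbabilityMeasure (haarState l) := by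
  have h0 : (volume : Measure (EuclideanSpace ℂ (Str l))).toSphere Set.univ ≠ 0 := by
    rw [Ne, Measure.measure_univ_eq_zero]
    exact Measure.toSphere_ne_zero _
  refine ⟨?_⟩
  rw [haarState, Measure.smul_apply, smul_eq_mul]
  exact ENNReal.inv_mul_cancel h0 (measure_ne_top _ _)

/-- The response vector `U |φ⟩` of the device `U` to the challenge `φ`. -/
noncomputable def response {l : ℕ} (U : Matrix.unitaryGroup (Str l) ℂ) (φ : PureState l) :
    Str l → ℂ := U.1 *ᵥ (fun x => φ.1 x)

/-- The fidelity `F(σ, |ψ⟩⟨ψ|) = √⟨ψ|σ|ψ⟩` of a density matrix and a pure state. -/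
noncomputable def fidelity {l : ℕ} (σ : Matrix (Str l) (Str l) ℂ) (ψ : Str l → ℂ) : ℝ :=
  Real.sqrt (star ψ ⬝ᵥ (σ *ᵥ ψ)).re

/-! ### Adversaries -/

/-- An adversary (for one value `l` of the security parameter) that has to answer challenges in the
rounds `r : R`. She has `work` qubits, which start in a state that does not depend on the device.
She first runs the circuit `learn`, with queries to the device. Afterwards she has lost the device;
she is handed the challenge register (`l` qubits) of every round, and runs the circuit `attack` on
all the wires. The content of the challenge registers is then sent back as her reply. -/
structure Adversary (l : ℕ) (R : Type) where
  work : ℕ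
  advice : Str work → ℂ
  advice_norm : ∑ x, ‖advice x‖ ^ 2 = 1
  learn : List (LearnStep l (Fin work))
  attack : List (Gate (Fin work ⊕ R × Fin l))

namespace Adversary

variable {l : ℕ} {R : Type} [Fintype R] [DecidableEq R]

/-- Number of qubits plus number of gates and queries. -/
def size (A : Adversary l R) : ℕ := A.work + A.learn.length + A.attack.length

/-- The state of the work qubits after the learning phase. -/
noncomputable def learned (A : Adversary l R) (U : Matrix.unitaryGroup (Str l) ℂ) :
    Str A.work → ℂ :=
  A.learn.foldl (fun v s => s.matrix U *ᵥ v) A.advice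

/-- The joint state of all wires after the attack, if the challenge of round `r` is `φ r`. -/
noncomputable def final (A : Adversary l R) (U : Matrix.unitaryGroup (Str l) ℂ)
    (φ : R → PureState l) : (Fin A.work ⊕ R × Fin l → Bool) → ℂ :=
  A.attack.foldl (fun v g => g.matrix *ᵥ v)
    (fun x => A.learned U (fun w => x (Sum.inl w)) *
      ∏ r, (φ r).1 (fun k => x (Sum.inr (r, k))))

/-- The (possibly entangled) density matrix of the reply registers of all rounds: the partial trace
of the final state over the work qubits. -/
noncomputable def reply (A : Adversary l R) (U : Matrix.unitaryGroup (Str l) ℂ)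
    (φ : R → PureState l) : Matrix (R → Str l) (R → Str l) ℂ :=
  Matrix.of fun x y => ∑ z : Str A.work,
    A.final U φ (Sum.elim z fun p => x p.1 p.2) *
      star (A.final U φ (Sum.elim z fun p => y p.1 p.2))

end Adversary

/-- The reduced density matrix of round `r`: partial trace over the registers of the others. -/
noncomputable def marginal {l : ℕ} {R : Type} [Fintype R] [DecidableEq R]
    (ρ : Matrix (R → Str l) (R → Str l) ℂ) (r : R) : Matrix (Str l) (Str l) ℂ :=
  Matrix.of fun a b => ∑ x : R → Str l, if x r = a then ρ x (Function.update x r b) else 0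

/-- The state is a tensor product, over the rounds, of density matrices. -/
def Unentangled {l : ℕ} {R : Type} [Fintype R] (ρ : Matrix (R → Str l) (R → Str l) ℂ) : Prop :=
  ∃ σ : R → Matrix (Str l) (Str l) ℂ, (∀ r, (σ r).PosSemidef ∧ (σ r).trace = 1) ∧
    ρ = Matrix.of fun x y => ∏ r, σ r (x r) (y r)

/-- A family of adversaries is QPT: polynomially many qubits, gates and queries. This is the usual
non-uniform notion, with initial work states (quantum advice) that do not depend on the device. -/
def QPT {R : ℕ → Type} (A : ∀ l, Adversary l (R l)) : Prop := PolyBounded fun l => (A l).size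

/-! ### Selective unforgeability -/

/-- Probability, over the device and one Haar random challenge `φ`, that the adversary's reply to
`φ` has fidelity at least `δ` with the response of the device. -/
noncomputable def UnitaryQPUF.forgeProb (P : UnitaryQPUF) {l : ℕ} (A : Adversary l Unit)
    (δ : ℝ) : ℝ :=
  ((P.law l).prod (haarState l)).real
    {p | δ ≤ fidelity (marginal (A.reply p.1 fun _ => p.2) ()) (response p.1 p.2)}

/-- Selective unforgeability: no QPT adversary answers a Haar random challenge with non-negligible
fidelity (at least some inverse polynomial), except with negligible probability. -/
def UnitaryQPUF.SelectivelyUnforgeable (P : UnitaryQPUF) : Prop :=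
  ∀ A : ∀ l, Adversary l Unit, QPT A →
    ∀ c : ℕ, Negligible fun l => P.forgeProb (A l) (1 / ((l : ℝ) + 1) ^ c)

/-! ### The SWAP test and the protocol -/

/-- The SWAP test circuit on an ancilla qubit and two registers with basis `H`: Hadamard on the
ancilla, SWAP of the registers controlled by the ancilla, Hadamard on the ancilla. -/
noncomputable def swapCircuit (H : Type) [Fintype H] [DecidableEq H] :
    Matrix (Bool × H × H) (Bool × H × H) ℂ :=
  (hadamardBit ⊗ₖ (1 : Matrix (H × H) (H × H) ℂ)) *
    (Matrix.of fun p q => if p = (q.1, if q.1 then q.2.swap else q.2) then 1 else 0) *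
    (hadamardBit ⊗ₖ (1 : Matrix (H × H) (H × H) ℂ))

/-- The part `K = (⟨0| ⊗ 1) V (|0⟩ ⊗ 1)` of the SWAP test circuit `V` that starts with ancilla `0`
and accepts, i.e. measures ancilla `0`. -/
noncomputable def swapKraus (H : Type) [Fintype H] [DecidableEq H] : Matrix (H × H) (H × H) ℂ :=
  Matrix.of fun p q => swapCircuit H (false, p) (false, q)

/-- The effect (POVM element) of acceptance in the SWAP test. -/
noncomputable def swapEffect (H : Type) [Fintype H] [DecidableEq H] : Matrix (H × H) (H × H) ℂ :=
  (swapKraus H)ᴴ * swapKraus H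

/-- The probability that all the SWAP tests accept, when in round `r` the register `r` of the joint
state `ρ` is tested against the stored pure state `ψ r`. -/
noncomputable def allSwapAccept {l : ℕ} {R : Type} [Fintype R] [DecidableEq R]
    (ρ : Matrix (R → Str l) (R → Str l) ℂ) (ψ : R → Str l → ℂ) : ℝ :=
  (Matrix.trace
    ((Matrix.of fun x y : R → Str l × Str l =>
        ρ (fun r => (x r).1) (fun r => (y r).1) * ∏ r, (ψ r (x r).2 * star (ψ r (y r).2))) *
      (Matrix.of fun x y : R → Str l × Str l => ∏ r, swapEffect (Str l) (x r) (y r)))).re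

section Protocol

variable {l N M : ℕ}

/-- The joint state that Eve sends to the verifier in the protocol with `N` distinct challenges
`φ i`, each of them sent in `M` rounds `(i, j)`. -/
noncomputable def eveReply (E : Adversary l (Fin N × Fin M))
    (U : Matrix.unitaryGroup (Str l) ℂ) (φ : Fin N → PureState l) :
    Matrix (Fin N × Fin M → Str l) (Fin N × Fin M → Str l) ℂ :=
  E.reply U fun r => φ r.1

/-- The probability that Eve passes all `N * M` SWAP tests, for given device and challenges; the
verifier has `M` copies of the response to each challenge. -/
noncomputable def accept (E : Adversary l (Fin N × Fin M))
    (U : Matrix.unitaryGroup (Str l) ℂ) (φ : Fin N → PureState l) : ℝ :=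
  allSwapAccept (eveReply E U φ) fun r => response U (φ r.1)

/-- `F_i`: the maximal fidelity, over the `M` rounds with challenge `i`, of the state received in
the round with the correct response (`0` if there is no round). -/
noncomputable def maxFidelity (E : Adversary l (Fin N × Fin M))
    (U : Matrix.unitaryGroup (Str l) ℂ) (φ : Fin N → PureState l) (i : Fin N) : ℝ :=
  ⨆ j : Fin M, fidelity (marginal (eveReply E U φ) (i, j)) (response U (φ i))

/-- `∏ i, (1/2 + F_i ^ 2 / 2) ^ M`. -/
noncomputable def productBound (E : Adversary l (Fin N × Fin M))
    (U : Matrix.unitaryGroup (Str l) ℂ) (φ : Fin N → PureState l) : ℝ :=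
  ∏ i, (1 / 2 + maxFidelity E U φ i ^ 2 / 2) ^ M

/-- Joint law of the device and of `N` independent Haar random challenges. -/
noncomputable def UnitaryQPUF.gameLaw (P : UnitaryQPUF) (l N : ℕ) :
    Measure (Matrix.unitaryGroup (Str l) ℂ × (Fin N → PureState l)) :=
  (P.law l).prod (Measure.pi fun _ => haarState l)

/-- The probability that the verifier accepts Eve. -/
noncomputable def UnitaryQPUF.acceptProb (P : UnitaryQPUF) (E : Adversary l (Fin N × Fin M)) :
    ℝ :=
  ∫ p, accept E p.1 p.2 ∂(P.gameLaw l N)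

/-- The mean of `∏ i, (1/2 + F_i ^ 2 / 2) ^ M` over device and challenges. -/
noncomputable def UnitaryQPUF.meanProductBound (P : UnitaryQPUF)
    (E : Adversary l (Fin N × Fin M)) : ℝ :=
  ∫ p, productBound E p.1 p.2 ∂(P.gameLaw l N)

end Protocol

end SwapId

/-!
The SWAP test against the stored response `ψ` measures the effect `(1 + |ψ⟩⟨ψ|) / 2`. Therefore the
probability that all `N * M` tests accept is the average, over the sets `T` of rounds, of the
probability that the rounds of `T` pass the projective test on the correct response. The empty set
contributes `2 ^ (-N * M)`, and any other set at most the squared fidelity of one of its rounds, so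
that `accept ≤ 2 ^ (-N * M) + ∑ F (ρ_{i,j}, ψ_i) ^ 2`, for entangled replies, too (`accept_le`). The
product `∏ (1 / 2 + F_i ^ 2 / 2) ^ M` lies between `2 ^ (-N * M)` and the same upper bound. All
the asymptotic claims follow once the mean `totalFidelitySq` of the sum of the squared fidelities is
known to be negligible (`negligible_totalFidelitySq`). For a tensor product of replies, the tests
are independent, and the bound holds exactly (`accept_le_productBound`).

The fidelity in one round cannot be bounded by unforgeability at once, because Eve receives `M`
copies of each challenge and an adversary of the unforgeability game only one. This is overcome by
the moments of Haar random states. Let `T φ` be a vector in dimension `D` that is given by a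
polynomial of degree `m + 1` in the state `φ`. The Gaussian integration by parts yields the energy
identity `integral_haarState_energy`:
`(D + m + 1) (D + m) E |⟨φ, T φ⟩| ^ 2 = (D + m) E ‖T φ‖ ^ 2 + E |∑ i, τ_i φ| ^ 2`,
where `τ_i` is the partial trace of `T` that contracts the output with the `i`-th copy of `φ`. The
first term on the right is exponentially small after division, as a reply has norm `1`. The second
one is bounded by the same identity for one copy, where `τ_i χ` is the trace of an operator in a
single copy of `φ`. Hence `M` copies of `φ` are hardly better than a single copy of `φ`, in one of
the `M` rounds, with copies of an independent Haar random state `χ` in the others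
(`integral_haarState_copies_le`).

The state `χ` and the other challenges `φ_k` are independent of the device and of `φ`, and so
they may be fixed and moved to the quantum advice. What remains is an adversary of the
unforgeability game (`Adversary.single`), which exchanges the challenge register with the correct
one by CNOT gates and then runs Eve's circuits. Its size is polynomial, and for each security
parameter a nearly optimal choice of the rounds and of the advice is taken.
-/

namespace SwapId

/-! ### Moments of Haar random pure states -/

/-- The mixed moment `z ^ a * conj z ^ b` of the (unnormalized) complex Gaussian. -/
theorem integral_pow_mul_conj_pow_mul_exp (a b : ℕ) :
    ∫ z : ℂ, z ^ a * star z ^ b * (Real.exp (-‖z‖ ^ 2) : ℂ) =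
      if a = b then (Real.pi * a.factorial : ℂ) else 0 := by
  split_ifs with h
  · subst h
    have h1 : ∀ z : ℂ, z ^ a * star z ^ a * (Real.exp (-‖z‖ ^ 2) : ℂ) =
        ((‖z‖ ^ ((2 * a : ℕ) : ℝ) * Real.exp (-‖z‖ ^ (2 : ℝ)) : ℝ) : ℂ) := by
      intro z
      rw [← mul_pow, Complex.star_def, Complex.mul_conj, Complex.normSq_eq_norm_sq,
        Real.rpow_natCast, Real.rpow_two, pow_mul]
      push_cast
      rfl
    simp_rw [h1]
    rw [integral_complex_ofReal,
      Complex.integral_rpow_mul_exp_neg_rpow (by norm_num) (by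
        have : (0 : ℝ) ≤ ((2 * a : ℕ) : ℝ) := by positivity
        linarith)]
    have h2 : (((2 * a : ℕ) : ℝ) + 2) / 2 = (a : ℝ) + 1 := by push_cast; ring
    rw [h2, Real.Gamma_nat_eq_factorial]
    push_cast
    ring
  · -- the rotation by `w` with `w ^ (a - b) = -1` changes the sign of the integral
    obtain ⟨w, hw, hwab⟩ : ∃ w : Circle, star (w : ℂ) * w = 1 ∧
        (w : ℂ) ^ a * star (w : ℂ) ^ b = -1 := by
      refine ⟨Circle.exp (Real.pi / ((a : ℝ) - b)), ?_, ?_⟩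
      · rw [mul_comm, Complex.star_def, Complex.mul_conj, Circle.normSq_coe, Complex.ofReal_one]
      · have hab : (a : ℂ) - b ≠ 0 := by
          rw [sub_ne_zero]; exact_mod_cast h
        rw [Circle.coe_exp, Complex.star_def, ← Complex.exp_conj, ← Complex.exp_nat_mul,
          ← Complex.exp_nat_mul, ← Complex.exp_add, ← Complex.exp_pi_mul_I]
        congr 1
        simp only [map_mul, Complex.conj_ofReal, Complex.conj_I]
        push_cast
        field_simp
        ring
    have h1 := (rotation w).measurePreserving.integral_comp
      (rotation w).toHomeomorph.measurableEmbedding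
      (fun z : ℂ => z ^ a * star z ^ b * (Real.exp (-‖z‖ ^ 2) : ℂ))
    have h2 : ∀ z : ℂ, (rotation w z) ^ a * star (rotation w z) ^ b *
        (Real.exp (-‖rotation w z‖ ^ 2) : ℂ) =
        -(z ^ a * star z ^ b * (Real.exp (-‖z‖ ^ 2) : ℂ)) := by
      intro z
      rw [LinearIsometryEquiv.norm_map, rotation_apply, star_mul', mul_pow, mul_pow]
      linear_combination (z ^ a * star z ^ b * (Real.exp (-‖z‖ ^ 2) : ℂ)) * hwab
    simp_rw [h2, integral_neg] at h1
    exact self_eq_neg.mp h1.symm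

section HaarMoments

variable {S : Type} [Fintype S]

/-- Integration in polar coordinates of a homogeneous function against a Gaussian. -/
theorem integral_mul_exp_eq_toSphere {E : Type*} [NormedAddCommGroup E] [NormedSpace ℝ E]
    [MeasurableSpace E] [BorelSpace E] [FiniteDimensional ℝ E] [Nontrivial E] (μ : Measure E)
    [μ.IsAddHaarMeasure] (F : E → ℂ) (n : ℕ)
    (hF : ∀ (r : ℝ) (z : E), 0 < r → F (r • z) = (r : ℂ) ^ n * F z) :
    ∫ z, F z * (Real.exp (-‖z‖ ^ 2) : ℂ) ∂μ =
      (∫ y, F y.1 ∂μ.toSphere) *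
        (Real.Gamma (((n : ℝ) + Module.finrank ℝ E) / 2) / 2 : ℝ) := by
  have hpos : 0 < Module.finrank ℝ E := Module.finrank_pos
  set d := Module.finrank ℝ E with hd
  have hpt : ∀ x : ({(0 : E)}ᶜ : Set E), F x * (Real.exp (-‖(x : E)‖ ^ 2) : ℂ) =
      (fun p : Metric.sphere (0 : E) 1 × Set.Ioi (0 : ℝ) =>
        F p.1 * ((p.2 : ℝ) ^ n * Real.exp (-(p.2 : ℝ) ^ 2) : ℝ))
        (homeomorphUnitSphereProd E x) := by
    intro x
    have hx : 0 < ‖(x : E)‖ := norm_pos_iff.2 x.2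
    simp only [homeomorphUnitSphereProd_apply_snd_coe, homeomorphUnitSphereProd_apply_fst_coe]
    have h3 : F x = (‖(x : E)‖ : ℂ) ^ n * F (‖(x : E)‖⁻¹ • (x : E)) := by
      rw [← hF _ _ hx, smul_inv_smul₀ hx.ne']
    rw [h3]
    push_cast
    ring
  calc
    ∫ z, F z * (Real.exp (-‖z‖ ^ 2) : ℂ) ∂μ
      = ∫ x : ({(0 : E)}ᶜ : Set E), F x * (Real.exp (-‖(x : E)‖ ^ 2) : ℂ) ∂(μ.comap (↑)) := by
        rw [integral_subtype_comap (measurableSet_singleton _).compl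
          fun x => F x * (Real.exp (-‖x‖ ^ 2) : ℂ), restrict_compl_singleton]
    _ = ∫ p, F p.1.1 * (((p.2 : ℝ) ^ n * Real.exp (-(p.2 : ℝ) ^ 2) : ℝ) : ℂ)
          ∂μ.toSphere.prod (.volumeIoiPow (d - 1)) := by
        simp_rw [hpt]
        exact μ.measurePreserving_homeomorphUnitSphereProd.integral_comp
          (Homeomorph.measurableEmbedding _)
          (fun p : Metric.sphere (0 : E) 1 × Set.Ioi (0 : ℝ) =>
            F p.1 * (((p.2 : ℝ) ^ n * Real.exp (-(p.2 : ℝ) ^ 2) : ℝ) : ℂ))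
    _ = (∫ y, F y.1 ∂μ.toSphere) *
          ∫ r : Set.Ioi (0 : ℝ), (((r : ℝ) ^ n * Real.exp (-(r : ℝ) ^ 2) : ℝ) : ℂ)
            ∂.volumeIoiPow (d - 1) :=
        integral_prod_mul (fun y : Metric.sphere (0 : E) 1 => F y.1)
          (fun r : Set.Ioi (0 : ℝ) => (((r : ℝ) ^ n * Real.exp (-(r : ℝ) ^ 2) : ℝ) : ℂ))
    _ = _ := by
        congr 1
        rw [integral_complex_ofReal]
        congr 1
        simp only [Measure.volumeIoiPow, ENNReal.ofReal]
        rw [integral_withDensity_eq_integral_smul,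
          integral_subtype_comap measurableSet_Ioi
            fun a : ℝ => Real.toNNReal (a ^ (d - 1)) • (a ^ n * Real.exp (-a ^ 2))]
        · have h4 : ∫ r in Set.Ioi (0 : ℝ),
              Real.toNNReal (r ^ (d - 1)) • (r ^ n * Real.exp (-r ^ 2)) =
              ∫ r in Set.Ioi (0 : ℝ), r ^ ((n + (d - 1) : ℕ) : ℝ) * Real.exp (-r ^ (2 : ℝ)) := by
            refine setIntegral_congr_fun measurableSet_Ioi fun r hr => ?_
            rw [NNReal.smul_def, Real.coe_toNNReal _ (pow_nonneg (le_of_lt hr) _), smul_eq_mul,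
              Real.rpow_natCast, Real.rpow_two, pow_add]
            ring
          rw [h4, integral_rpow_mul_exp_neg_rpow (by norm_num) (by
            have : (0 : ℝ) ≤ ((n + (d - 1) : ℕ) : ℝ) := by positivity
            linarith)]
          have h5 : ((n + (d - 1) : ℕ) : ℝ) + 1 = n + d := by
            rw [Nat.cast_add, Nat.cast_sub (by omega)]; push_cast; ring
          rw [h5]
          ring
        · exact (measurable_subtype_coe.pow_const _).real_toNNReal

/-- The value at `z` of the monomial with exponents `α` in `z` and `β` in `conj z`. -/
noncomputable def mixedMonomial (α β : S → ℕ) (z : S → ℂ) : ℂ :=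
  ∏ s, z s ^ α s * star (z s) ^ β s

theorem mixedMonomial_smul (α β : S → ℕ) (r : ℝ) (z : S → ℂ) :
    mixedMonomial α β (fun s => (r : ℂ) * z s) =
      (r : ℂ) ^ (∑ s, (α s + β s)) * mixedMonomial α β z := by
  simp only [mixedMonomial, ← Finset.prod_pow_eq_pow_sum, ← Finset.prod_mul_distrib]
  refine Finset.prod_congr rfl fun s _ => ?_
  rw [star_mul', Complex.star_def, Complex.conj_ofReal, mul_pow, mul_pow, pow_add]
  ring

/-- The moments of a vector of independent complex Gaussians, by Fubini's theorem. -/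
theorem integral_mixedMonomial_mul_exp (α β : S → ℕ) :
    ∫ z : S → ℂ, mixedMonomial α β z * (Real.exp (-∑ s, ‖z s‖ ^ 2) : ℂ) =
      if α = β then (Real.pi : ℂ) ^ Fintype.card S * ∏ s, ((α s).factorial : ℂ) else 0 := by
  have h1 : ∀ z : S → ℂ, mixedMonomial α β z * (Real.exp (-∑ s, ‖z s‖ ^ 2) : ℂ) =
      ∏ s, (z s ^ α s * star (z s) ^ β s * (Real.exp (-‖z s‖ ^ 2) : ℂ)) := by
    intro z
    rw [Finset.prod_mul_distrib, mixedMonomial, ← Finset.sum_neg_distrib, Real.exp_sum]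
    push_cast
    rfl
  simp_rw [h1]
  rw [volume_pi, integral_fintype_prod_eq_prod
    (fun s (z : ℂ) => z ^ α s * star z ^ β s * (Real.exp (-‖z‖ ^ 2) : ℂ))]
  simp_rw [integral_pow_mul_conj_pow_mul_exp]
  split_ifs with h
  · subst h
    simp [Finset.prod_mul_distrib]
  · obtain ⟨s, hs⟩ := Function.ne_iff.mp h
    exact Finset.prod_eq_zero (Finset.mem_univ s) (if_neg hs)

end HaarMoments

/-- The Gaussian moments determine the moments of the uniform distribution on the sphere, up to the
total mass of the sphere. -/
theorem integral_haarState_mixedMonomial {l : ℕ} (α β : Str l → ℕ) :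
    ∫ φ : PureState l, mixedMonomial α β (fun s => φ.1 s) ∂haarState l =
      if α = β then (∏ s, ((α s).factorial : ℂ)) / ((2 ^ l).ascFactorial (∑ s, α s) : ℕ)
      else 0 := by
  let E := EuclideanSpace ℂ (Str l)
  let μ : Measure E := volume
  let e : (Str l → ℂ) ≃L[ℝ] E :=
    (PiLp.continuousLinearEquiv 2 ℝ (fun _ : Str l => ℂ)).symm
  have hfr : Module.finrank ℝ E = 2 * 2 ^ l := by
    rw [finrank_real_of_complex, finrank_euclideanSpace]
    simp
  -- both measures are Haar measures
  obtain ⟨c, hc0, hc⟩ : ∃ c : ℝ, c ≠ 0 ∧ ∀ f : E → ℂ,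
      ∫ z, f z ∂μ = c * ∫ z : Str l → ℂ, f (e z) := by
    have : (Measure.map e (volume : Measure (Str l → ℂ))).IsAddHaarMeasure :=
      e.isAddHaarMeasure_map _
    have h1 := Measure.isAddLeftInvariant_eq_smul μ (Measure.map e (volume : Measure (Str l → ℂ)))
    have h2 : Measure.addHaarScalarFactor μ (Measure.map e (volume : Measure (Str l → ℂ))) ≠ 0 :=
      (Measure.addHaarScalarFactor_pos_of_isAddHaarMeasure _ _).ne'
    refine ⟨Measure.addHaarScalarFactor μ (Measure.map e (volume : Measure (Str l → ℂ))),
      by exact_mod_cast h2, fun f => ?_⟩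
    conv_lhs => rw [h1]
    rw [integral_smul_nnreal_measure, (show MeasurableEmbedding e from
      e.toHomeomorph.measurableEmbedding).integral_map]
    rw [NNReal.smul_def, Complex.real_smul]
  have key : ∀ α β : Str l → ℕ,
      (c : ℂ) * (if α = β then (Real.pi : ℂ) ^ 2 ^ l * ∏ s, ((α s).factorial : ℂ) else 0) =
      (∫ y : PureState l, mixedMonomial α β (fun s => y.1 s) ∂μ.toSphere) *
        (Real.Gamma (((∑ s, (α s + β s) : ℕ) + (2 * 2 ^ l : ℕ) : ℝ) / 2) / 2 : ℝ) := by
    intro α β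
    have h1 := integral_mul_exp_eq_toSphere μ (fun z => mixedMonomial α β (fun s => z s))
      (∑ s, (α s + β s)) (fun r z _ => by
        rw [← mixedMonomial_smul]
        rfl)
    rw [hfr] at h1
    rw [← h1, hc]
    have h2 := integral_mixedMonomial_mul_exp α β
    rw [show Fintype.card (Str l) = 2 ^ l by simp] at h2
    rw [← h2]
    congr 2
    ext z
    rw [EuclideanSpace.norm_sq_eq]
    rfl
  -- the case of degree zero gives the total mass of the sphere
  have h0 := key 0 0
  have hsc : ∀ f : PureState l → ℂ, ∫ y, f y ∂haarState l =
      ((μ.toSphere Set.univ)⁻¹).toReal * ∫ y, f y ∂μ.toSphere := by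
    intro f
    rw [haarState, integral_smul_measure, Complex.real_smul]
  rw [hsc]
  have hone : ((μ.toSphere Set.univ)⁻¹.toReal : ℂ) *
      ∫ y : PureState l, (1 : ℂ) ∂μ.toSphere = 1 := by
    rw [← hsc]
    simp
  have hk := key α β
  set Z : ℂ := ((μ.toSphere Set.univ)⁻¹.toReal : ℂ)
  have hZ : Z ≠ 0 := left_ne_zero_of_mul_eq_one hone
  have hG : ∀ n : ℕ, (Real.Gamma (((n : ℕ) + (2 * 2 ^ l : ℕ) : ℝ) / 2) / 2 : ℝ) ≠ 0 := by
    intro n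
    have : 0 < Real.Gamma (((n : ℕ) + (2 * 2 ^ l : ℕ) : ℝ) / 2) :=
      Real.Gamma_pos_of_pos (by positivity)
    positivity
  split_ifs with h
  · subst h
    rw [if_pos rfl] at hk h0
    have hG2 : ∀ n : ℕ, Real.Gamma (((2 * n : ℕ) + (2 * 2 ^ l : ℕ) : ℝ) / 2) =
        Real.Gamma (2 ^ l) * (2 ^ l).ascFactorial n := by
      intro n
      induction n with
      | zero => simp
      | succ n ih =>
        rw [Nat.ascFactorial_succ, show (((2 * (n + 1) : ℕ) + (2 * 2 ^ l : ℕ) : ℝ) / 2) =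
          (((2 * n : ℕ) + (2 * 2 ^ l : ℕ) : ℝ) / 2) + 1 by push_cast; ring,
          Real.Gamma_add_one (by positivity), ih]
        push_cast
        ring
    have hs : ∑ s, (α s + α s) = 2 * ∑ s, α s := by
      rw [Finset.mul_sum]
      exact Finset.sum_congr rfl fun s _ => (two_mul _).symm
    have hs0 : ∑ s : Str l, ((0 : Str l → ℕ) s + (0 : Str l → ℕ) s) = 2 * 0 := by simp
    rw [hs, hG2] at hk
    rw [hs0, hG2] at h0
    simp only [mixedMonomial, Pi.zero_apply, pow_zero, mul_one, Finset.prod_const_one,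
      Nat.factorial_zero, Nat.cast_one, Nat.ascFactorial_zero] at h0
    have hGpos : (Real.Gamma (2 ^ l) : ℂ) ≠ 0 := by
      exact_mod_cast (Real.Gamma_pos_of_pos (by positivity)).ne'
    have hasc : (((2 ^ l).ascFactorial (∑ s, α s) : ℕ) : ℂ) ≠ 0 := by
      have : 0 < (2 ^ l).ascFactorial (∑ s, α s) := by
        rw [← Nat.sub_add_cancel (Nat.one_le_two_pow (n := l))]
        exact Nat.ascFactorial_pos _ _
      exact_mod_cast this.ne'
    rw [eq_div_iff hasc]
    push_cast at hk h0
    set J := ∫ y : PureState l, mixedMonomial α α (fun s => y.1 s) ∂μ.toSphere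
    set I1 := ∫ y : PureState l, (1 : ℂ) ∂μ.toSphere
    set A : ℂ := (((2 ^ l).ascFactorial (∑ s, α s) : ℕ) : ℂ)
    set p := ∏ s, ((α s).factorial : ℂ)
    have e1 : I1 * p = J * A := by
      apply mul_right_cancel₀ hGpos
      linear_combination 2 * hk - 2 * p * h0
    linear_combination (-Z) * e1 + p * hone
  · rw [if_neg h, mul_zero] at hk
    have := (mul_eq_zero.mp hk.symm).resolve_right (by exact_mod_cast hG _)
    rw [this, mul_zero]


section Occupation

variable {S : Type}

/-- The mixed moments of independent standard complex Gaussians, i.e. those with density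
`exp (-‖z‖ ^ 2) / π`. -/
noncomputable def gaussianMoment [Fintype S] (α β : S → ℕ) : ℂ :=
  if α = β then ∏ s, ((α s).factorial : ℂ) else 0

theorem gaussianMoment_comm [Fintype S] (α β : S → ℕ) :
    gaussianMoment α β = gaussianMoment β α := by
  unfold gaussianMoment
  by_cases h : α = β
  · rw [h]
  · rw [if_neg h, if_neg (Ne.symm h)]

variable [DecidableEq S]

/-- Occupation numbers of the list of basis states `v i`, `i ∈ A`. -/
def occupation {ι : Type} (A : Finset ι) (v : ι → S) : S → ℕ :=
  ∑ i ∈ A, Pi.single (v i) 1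

variable {ι : Type}

theorem occupation_apply (A : Finset ι) (v : ι → S) (y : S) :
    occupation A v y = ∑ i ∈ A, if v i = y then 1 else 0 := by
  simp only [occupation, Finset.sum_apply, Pi.single_apply, eq_comm]

theorem sum_occupation [Fintype S] (A : Finset ι) (v : ι → S) :
    ∑ y, occupation A v y = A.card := by
  simp_rw [occupation_apply]
  rw [Finset.sum_comm]
  simp

theorem occupation_erase [DecidableEq ι] (A : Finset ι) (v : ι → S) {i : ι} (hi : i ∈ A) :
    occupation (A.erase i) v = occupation A v - Pi.single (v i) 1 := by
  rw [occupation, occupation, ← Finset.sum_erase_add _ _ hi, add_tsub_cancel_right]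

theorem mixedMonomial_occupation [Fintype S] (A B : Finset ι) (v w : ι → S) (z : S → ℂ) :
    mixedMonomial (occupation A v) (occupation B w) z =
      (∏ i ∈ A, z (v i)) * ∏ i ∈ B, star (z (w i)) := by
  have h : ∀ (C : Finset ι) (u : ι → S) (f : S → ℂ),
      ∏ s, f s ^ occupation C u s = ∏ i ∈ C, f (u i) := by
    intro C u f
    simp_rw [occupation_apply, ← Finset.prod_pow_eq_pow_sum]
    rw [Finset.prod_comm]
    refine Finset.prod_congr rfl fun i _ => ?_
    simp [pow_ite]
  rw [mixedMonomial, Finset.prod_mul_distrib, h A v z, h B w fun s => star (z s)]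

theorem mixedMonomial_add_single [Fintype S] (α β : S → ℕ) (y y' : S) (z : S → ℂ) :
    mixedMonomial (α + Pi.single y' 1) (β + Pi.single y 1) z =
      star (z y) * z y' * mixedMonomial α β z := by
  have h : ∀ (u : S) (f : S → ℂ), ∏ s, f s ^ (Pi.single u 1 : S → ℕ) s = f u := by
    intro u f
    simp [Pi.single_apply, pow_ite]
  simp only [mixedMonomial, Finset.prod_mul_distrib, Pi.add_apply, pow_add]
  rw [h y' z, h y fun s => star (z s)]
  ring

variable [Fintype S]

theorem gaussianMoment_add_single_add_single (α β : S → ℕ) (y : S) :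
    gaussianMoment (α + Pi.single y 1) (β + Pi.single y 1) = (α y + 1) * gaussianMoment α β := by
  unfold gaussianMoment
  simp only [add_left_inj]
  split_ifs with h
  · rw [← Finset.mul_prod_erase _ _ (Finset.mem_univ y),
      ← Finset.mul_prod_erase _ (fun s => ((α s).factorial : ℂ)) (Finset.mem_univ y)]
    have h1 : ∏ s ∈ Finset.univ.erase y, (((α + Pi.single y 1 : S → ℕ) s).factorial : ℂ) =
        ∏ s ∈ Finset.univ.erase y, ((α s).factorial : ℂ) := by
      refine Finset.prod_congr rfl fun s hs => ?_
      rw [Pi.add_apply, Pi.single_eq_of_ne (Finset.ne_of_mem_erase hs), add_zero]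
    rw [h1, Pi.add_apply, Pi.single_eq_same, Nat.factorial_succ]
    push_cast
    ring
  · simp

/-- Integration by parts in the variable `conj z y`. -/
theorem gaussianMoment_add_single_right (γ β : S → ℕ) (y : S) :
    gaussianMoment γ (β + Pi.single y 1) = γ y * gaussianMoment (γ - Pi.single y 1) β := by
  by_cases h : γ y = 0
  · rw [h, Nat.cast_zero, zero_mul, gaussianMoment, if_neg]
    intro h'
    rw [h'] at h
    simp at h
  · have h1 : γ = (γ - Pi.single y 1) + Pi.single y 1 := by
      ext s
      by_cases hs : s = y
      · subst hs
        simp only [Pi.add_apply, Pi.sub_apply, Pi.single_eq_same]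
        omega
      · simp [Pi.single_eq_of_ne hs]
    have h2 : (((γ - Pi.single y 1 : S → ℕ) y : ℕ) : ℂ) + 1 = γ y := by
      simp only [Pi.sub_apply, Pi.single_eq_same]
      exact_mod_cast Nat.sub_add_cancel (Nat.one_le_iff_ne_zero.2 h)
    conv_lhs => rw [h1]
    rw [gaussianMoment_add_single_add_single, h2]

theorem gaussianMoment_eq_sub_single (α β : S → ℕ) (y : S) :
    (α y : ℂ) * gaussianMoment α β =
      α y * β y * gaussianMoment (α - Pi.single y 1) (β - Pi.single y 1) := by
  by_cases h : β y = 0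
  · by_cases hα : α y = 0
    · simp [hα]
    · have : α ≠ β := fun h' => hα (h' ▸ h)
      simp [h, gaussianMoment, this]
  · have h1 : β = (β - Pi.single y 1) + Pi.single y 1 := by
      ext s
      by_cases hs : s = y
      · subst hs
        simp only [Pi.add_apply, Pi.sub_apply, Pi.single_eq_same]
        omega
      · simp [Pi.single_eq_of_ne hs]
    conv_lhs => rw [h1]
    rw [gaussianMoment_add_single_right]
    by_cases hα : α y = 0
    · simp [hα]
    by_cases h2 : α - Pi.single y 1 = β - Pi.single y 1
    · have h3 := congrFun h2 y
      simp only [Pi.sub_apply, Pi.single_eq_same] at h3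
      have h4 : α y = β y := by omega
      rw [h4]
      ring
    · simp [gaussianMoment, h2]

/-- Integration by parts in `conj z y`: the derivative hits either the extra factor `z y'`, or the
factors `z y` of the monomial. The factors `z y'` are then removed together with one `conj z y'`. -/
theorem gaussianMoment_add_single (α β : S → ℕ) (y y' : S) :
    gaussianMoment (α + Pi.single y' 1) (β + Pi.single y 1) =
      (if y = y' then gaussianMoment α β else 0) +
        α y * β y' * gaussianMoment (α - Pi.single y 1) (β - Pi.single y' 1) := by
  by_cases h : y = y'
  · subst h
    rw [gaussianMoment_add_single_add_single, if_pos rfl, add_mul,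
      gaussianMoment_eq_sub_single]
    ring
  · rw [gaussianMoment_add_single_right, if_neg h, zero_add, Pi.add_apply, Pi.single_eq_of_ne h,
      add_zero]
    by_cases hα : α y = 0
    · simp [hα]
    have h1 : α + Pi.single y' 1 - Pi.single y 1 = (α - Pi.single y 1) + Pi.single y' 1 := by
      ext s
      simp only [Pi.add_apply, Pi.sub_apply]
      by_cases hs : s = y
      · subst hs
        rw [Pi.single_eq_same, Pi.single_eq_of_ne h]
        omega
      · rw [Pi.single_eq_of_ne hs]
        omega
    rw [h1, gaussianMoment_comm, gaussianMoment_add_single_right, gaussianMoment_comm]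
    ring

end Occupation

section Energy

variable {l : ℕ}

theorem integrable_haarState {F : Type*} [NormedAddCommGroup F] [SecondCountableTopology F]
    {f : PureState l → F} (hf : Continuous f) : Integrable f (haarState l) :=
  hf.integrable_of_hasCompactSupport (HasCompactSupport.of_compactSpace f)

theorem continuous_coord (s : Str l) : Continuous fun φ : PureState l => φ.1 s := by
  fun_prop

/-- A Haar random state is a normalized Gaussian vector, whose norm is independent of the state; the
factor is the moment of the norm. -/
theorem integral_haarState_mixedMonomial_eq (α β : Str l → ℕ) {n : ℕ} (hα : ∑ s, α s = n) :
    ((2 ^ l).ascFactorial n : ℕ) * ∫ φ : PureState l, mixedMonomial α β (fun s => φ.1 s)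
      ∂haarState l = gaussianMoment α β := by
  rw [integral_haarState_mixedMonomial, hα, gaussianMoment]
  have h : (((2 ^ l).ascFactorial n : ℕ) : ℂ) ≠ 0 := by
    have : 0 < (2 ^ l).ascFactorial n := by
      rw [← Nat.sub_add_cancel (Nat.one_le_two_pow (n := l))]
      exact Nat.ascFactorial_pos _ _
    exact_mod_cast this.ne'
  split_ifs
  · field_simp
  · simp

variable {ι Ω : Type} [Fintype ι] [DecidableEq ι] [Fintype Ω]

/-- The recursion of the Haar moments that comes from integration by parts. -/
theorem integral_haarState_recursion (v w : ι → Str l) {m : ℕ} (hm : Fintype.card ι = m + 1)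
    (y y' : Str l) :
    ((2 : ℂ) ^ l + (m + 1)) * (2 ^ l + m) * ∫ φ : PureState l,
        star (φ.1 y) * φ.1 y' * ((∏ i, φ.1 (v i)) * ∏ i, star (φ.1 (w i))) ∂haarState l =
      (2 ^ l + m) * (if y = y' then
          ∫ φ : PureState l, (∏ i, φ.1 (v i)) * ∏ i, star (φ.1 (w i)) ∂haarState l else 0) +
        ∑ i, ∑ j, if v i = y ∧ w j = y' then
          ∫ φ : PureState l, (∏ k ∈ Finset.univ.erase i, φ.1 (v k)) *
            ∏ k ∈ Finset.univ.erase j, star (φ.1 (w k)) ∂haarState l else 0 := by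
  set α := occupation Finset.univ v with hα
  set β := occupation Finset.univ w with hβ
  have hαs : ∑ s, α s = m + 1 := by rw [hα, sum_occupation, Finset.card_univ, hm]
  have e1 : ∀ φ : PureState l, star (φ.1 y) * φ.1 y' *
      ((∏ i, φ.1 (v i)) * ∏ i, star (φ.1 (w i))) =
      mixedMonomial (α + Pi.single y' 1) (β + Pi.single y 1) (fun s => φ.1 s) := fun φ => by
    rw [mixedMonomial_add_single, hα, hβ, mixedMonomial_occupation]
  have e2 : ∀ φ : PureState l, (∏ i, φ.1 (v i)) * ∏ i, star (φ.1 (w i)) =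
      mixedMonomial α β (fun s => φ.1 s) := fun φ => by
    rw [hα, hβ, mixedMonomial_occupation]
  have e3 : ∀ i j, ∀ φ : PureState l, (∏ k ∈ Finset.univ.erase i, φ.1 (v k)) *
            ∏ k ∈ Finset.univ.erase j, star (φ.1 (w k)) =
      mixedMonomial (α - Pi.single (v i) 1) (β - Pi.single (w j) 1) (fun s => φ.1 s) := by
    intro i j φ
    rw [hα, hβ, ← occupation_erase _ _ (Finset.mem_univ i),
      ← occupation_erase _ _ (Finset.mem_univ j), mixedMonomial_occupation]
  simp_rw [e1, e2, e3]
  have a1 := integral_haarState_mixedMonomial_eq (l := l) (α + Pi.single y' 1)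
    (β + Pi.single y 1) (n := m + 2) (by
      simp only [Pi.add_apply, Finset.sum_add_distrib, hαs]
      simp)
  have a2 := integral_haarState_mixedMonomial_eq (l := l) α β hαs
  have a3 : ((2 ^ l).ascFactorial m : ℕ) * (∑ i, ∑ j, if v i = y ∧ w j = y' then
      ∫ φ : PureState l, mixedMonomial (α - Pi.single (v i) 1) (β - Pi.single (w j) 1)
        (fun s => φ.1 s) ∂haarState l else 0) =
      α y * β y' * gaussianMoment (α - Pi.single y 1) (β - Pi.single y' 1) := by
    have h1 : (α y : ℂ) = ∑ i, if v i = y then 1 else 0 := by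
      rw [hα, occupation_apply]; push_cast; rfl
    have h2 : (β y' : ℂ) = ∑ i, if w i = y' then 1 else 0 := by
      rw [hβ, occupation_apply]; push_cast; rfl
    rw [h1, h2, Finset.sum_mul_sum, Finset.sum_mul, Finset.mul_sum]
    refine Finset.sum_congr rfl fun i _ => ?_
    rw [Finset.sum_mul, Finset.mul_sum]
    refine Finset.sum_congr rfl fun j _ => ?_
    by_cases hi : v i = y
    · by_cases hj : w j = y'
      · subst hi hj
        simp only [and_self, if_true, mul_one, one_mul]
        refine integral_haarState_mixedMonomial_eq _ _ ?_
        rw [hα, ← occupation_erase _ _ (Finset.mem_univ i), sum_occupation,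
          Finset.card_erase_of_mem (Finset.mem_univ i), Finset.card_univ, hm]
        rfl
      · simp [hj]
    · simp [hi]
  have hA : (((2 ^ l).ascFactorial m : ℕ) : ℂ) ≠ 0 := by
    have : 0 < (2 ^ l).ascFactorial m := by
      rw [← Nat.sub_add_cancel (Nat.one_le_two_pow (n := l))]
      exact Nat.ascFactorial_pos _ _
    exact_mod_cast this.ne'
  rw [Nat.ascFactorial_succ, Nat.ascFactorial_succ, gaussianMoment_add_single] at a1
  rw [Nat.ascFactorial_succ] at a2
  push_cast at a1 a2
  apply mul_left_cancel₀ hA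
  by_cases hy : y = y'
  · rw [if_pos hy] at a1 ⊢
    linear_combination a1 - a2 - a3
  · rw [if_neg hy] at a1 ⊢
    linear_combination a1 - a3

/-- The energy identity: for a function `T φ` with values in `ℂ ^ D`, of degree `m + 1` in `φ`, the
mean of `|⟨φ, T φ⟩| ^ 2` over a Haar random state `φ` is a combination of the mean of `‖T φ‖ ^ 2`
and the mean of the squared modulus of the sum of the partial traces of `T`. -/
theorem integral_haarState_energy (a : Str l → Ω → ℂ) (x : Ω → ι → Str l) {m : ℕ}
    (hm : Fintype.card ι = m + 1) :
    ((2 : ℝ) ^ l + (m + 1)) * (2 ^ l + m) * ∫ φ : PureState l,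
        ‖∑ y, star (φ.1 y) * ∑ ω, a y ω * ∏ i, φ.1 (x ω i)‖ ^ 2 ∂haarState l =
      (2 ^ l + m) * ∫ φ : PureState l, ∑ y, ‖∑ ω, a y ω * ∏ i, φ.1 (x ω i)‖ ^ 2 ∂haarState l +
        ∫ φ : PureState l, ‖∑ i, ∑ ω, a (x ω i) ω *
          ∏ k ∈ Finset.univ.erase i, φ.1 (x ω k)‖ ^ 2 ∂haarState l := by
  -- squared moduli of sums of monomials, as double sums
  have hsq : ∀ z : ℂ, ((‖z‖ ^ 2 : ℝ) : ℂ) = z * star z := by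
    intro z
    rw [Complex.star_def, Complex.mul_conj, Complex.normSq_eq_norm_sq]
  have hdouble : ∀ {K : Type} [Fintype K] (c : K → ℂ) (f : K → PureState l → ℂ),
      (∀ k, Continuous (f k)) → ((∫ φ, ‖∑ k, c k * f k φ‖ ^ 2 ∂haarState l : ℝ) : ℂ) =
        ∑ k, ∑ k', c k * star (c k') * ∫ φ, f k φ * star (f k' φ) ∂haarState l := by
    intro K _ c f hf
    rw [← integral_complex_ofReal]
    simp_rw [hsq, star_sum, Finset.sum_mul_sum, star_mul']
    have hint : ∀ k k', Integrable
        (fun φ => c k * f k φ * (star (c k') * star (f k' φ))) (haarState l) := fun k k' =>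
      integrable_haarState (((continuous_const.mul (hf k))).mul
        (continuous_const.mul (hf k').star))
    rw [integral_finsetSum _ fun k _ => integrable_finsetSum _ fun k' _ => hint k k']
    refine Finset.sum_congr rfl fun k _ => ?_
    rw [integral_finsetSum _ fun k' _ => hint k k']
    refine Finset.sum_congr rfl fun k' _ => ?_
    rw [← integral_const_mul]
    congr 1
    ext φ
    ring
  have hX : ∀ (A : Finset ι) (v : ι → Str l),
      Continuous fun φ : PureState l => ∏ i ∈ A, φ.1 (v i) := by
    intro A v
    fun_prop
  have hXs : ∀ (A : Finset ι) (v : ι → Str l) (φ : PureState l),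
      star (∏ i ∈ A, φ.1 (v i)) = ∏ i ∈ A, star (φ.1 (v i)) := fun A v φ => by
    rw [Complex.star_def, map_prod]
  have h1 : ((∫ φ : PureState l, ‖∑ y, star (φ.1 y) * ∑ ω, a y ω * ∏ i, φ.1 (x ω i)‖ ^ 2
      ∂haarState l : ℝ) : ℂ) = ∑ p : Str l × Ω, ∑ q : Str l × Ω, a p.1 p.2 * star (a q.1 q.2) *
        ∫ φ : PureState l, star (φ.1 p.1) * φ.1 q.1 *
          ((∏ i, φ.1 (x p.2 i)) * ∏ i, star (φ.1 (x q.2 i))) ∂haarState l := by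
    have := hdouble (K := Str l × Ω) (fun p => a p.1 p.2)
      (fun p φ => star (φ.1 p.1) * ∏ i, φ.1 (x p.2 i)) (fun p => by fun_prop)
    simp only [star_mul', star_star, hXs] at this
    convert this using 6 with φ p _ q _ φ
    · rw [Fintype.sum_prod_type]
      refine Finset.sum_congr rfl fun y _ => ?_
      rw [Finset.mul_sum]
      refine Finset.sum_congr rfl fun ω _ => ?_
      ring
    · ring
  have h2 : ((∫ φ : PureState l, ∑ y, ‖∑ ω, a y ω * ∏ i, φ.1 (x ω i)‖ ^ 2 ∂haarState l : ℝ) : ℂ) =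
      ∑ y, ∑ ω, ∑ ω', a y ω * star (a y ω') *
        ∫ φ : PureState l, (∏ i, φ.1 (x ω i)) * ∏ i, star (φ.1 (x ω' i)) ∂haarState l := by
    rw [integral_finsetSum _ fun y _ => integrable_haarState (by fun_prop)]
    push_cast
    refine Finset.sum_congr rfl fun y _ => ?_
    rw [hdouble (a y) (fun ω φ => ∏ i, φ.1 (x ω i)) fun ω => hX _ _]
    simp_rw [hXs]
  have h3 : ((∫ φ : PureState l, ‖∑ i, ∑ ω, a (x ω i) ω *
          ∏ k ∈ Finset.univ.erase i, φ.1 (x ω k)‖ ^ 2 ∂haarState l : ℝ) : ℂ) =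
      ∑ p : ι × Ω, ∑ q : ι × Ω, a (x p.2 p.1) p.2 * star (a (x q.2 q.1) q.2) *
        ∫ φ : PureState l, (∏ k ∈ Finset.univ.erase p.1, φ.1 (x p.2 k)) *
            ∏ k ∈ Finset.univ.erase q.1, star (φ.1 (x q.2 k)) ∂haarState l := by
    have := hdouble (K := ι × Ω) (fun p => a (x p.2 p.1) p.2)
      (fun p φ => ∏ k ∈ Finset.univ.erase p.1, φ.1 (x p.2 k)) (fun p => hX _ _)
    simp only [hXs] at this
    rw [← this]
    simp_rw [Fintype.sum_prod_type]
  apply Complex.ofReal_injective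
  rw [Complex.ofReal_add, Complex.ofReal_mul, Complex.ofReal_mul _ (∫ _, ∑ y, _ ∂_), h1, h2, h3]
  push_cast
  have hT : ∀ J : Ω → Ω → ℂ, ∑ y, ∑ ω, ∑ ω', a y ω * star (a y ω') * J ω ω' =
      ∑ p : Str l × Ω, ∑ q : Str l × Ω, a p.1 p.2 * star (a q.1 q.2) *
        if p.1 = q.1 then J p.2 q.2 else 0 := by
    intro J
    simp_rw [Fintype.sum_prod_type]
    refine Finset.sum_congr rfl fun y _ => Finset.sum_congr rfl fun ω _ => ?_
    rw [Finset.sum_comm]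
    simp
  have hτ : ∀ K : ι → Ω → ι → Ω → ℂ, ∑ p : ι × Ω, ∑ q : ι × Ω,
      a (x p.2 p.1) p.2 * star (a (x q.2 q.1) q.2) * K p.1 p.2 q.1 q.2 =
      ∑ p : Str l × Ω, ∑ q : Str l × Ω, a p.1 p.2 * star (a q.1 q.2) *
        ∑ i, ∑ j, if x p.2 i = p.1 ∧ x q.2 j = q.1 then K i p.2 j q.2 else 0 := by
    intro K
    simp_rw [Fintype.sum_prod_type_right, Finset.mul_sum]
    refine Finset.sum_congr rfl fun ω _ => ?_
    have h4 : ∀ y ω', ∑ y', ∑ i, ∑ j, a y ω * star (a y' ω') *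
        (if x ω i = y ∧ x ω' j = y' then K i ω j ω' else 0) =
        ∑ i, if x ω i = y then
          ∑ j, a y ω * star (a (x ω' j) ω') * K i ω j ω' else 0 := by
      intro y ω'
      rw [Finset.sum_comm]
      refine Finset.sum_congr rfl fun i _ => ?_
      rw [Finset.sum_comm]
      split_ifs with hi
      · refine Finset.sum_congr rfl fun j _ => ?_
        simp [hi]
      · simp [hi]
    simp_rw [h4]
    rw [Finset.sum_comm, Finset.sum_comm (s := Finset.univ (α := Str l))]
    refine Finset.sum_congr rfl fun ω' _ => ?_
    rw [Finset.sum_comm (s := Finset.univ (α := Str l))]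
    simp
  rw [hT, hτ (fun i ω j ω' => ∫ φ : PureState l, (∏ k ∈ Finset.univ.erase i, φ.1 (x ω k)) *
    ∏ k ∈ Finset.univ.erase j, star (φ.1 (x ω' k)) ∂haarState l), Finset.mul_sum, Finset.mul_sum,
    ← Finset.sum_add_distrib]
  refine Finset.sum_congr rfl fun p _ => ?_
  rw [Finset.mul_sum, Finset.mul_sum, ← Finset.sum_add_distrib]
  refine Finset.sum_congr rfl fun q _ => ?_
  linear_combination (a p.1 p.2 * star (a q.1 q.2)) *
    integral_haarState_recursion (x p.2) (x q.2) hm p.1 q.1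

end Energy

section Copies

variable {l : ℕ} {ι Ω : Type} [Fintype ι] [DecidableEq ι] [Fintype Ω]

theorem integrable_integral_copies (a : Str l → Ω → ℂ) (x : Ω → ι → Str l) (i : ι) :
    Integrable (fun χ : PureState l => ∫ φ : PureState l, ‖∑ y, star (φ.1 y) * ∑ ω, a y ω *
      ∏ k, (Function.update (fun _ => χ) i φ k).1 (x ω k)‖ ^ 2 ∂haarState l) (haarState l) := by
  have hc : Continuous fun p : PureState l × PureState l => ‖∑ y, star (p.2.1 y) * ∑ ω, a y ω *
      ∏ k, (Function.update (fun _ => p.1) i p.2 k).1 (x ω k)‖ ^ 2 := by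
    have h4 : ∀ k, Continuous fun p : PureState l × PureState l =>
        (Function.update (fun _ => p.1) i p.2 k : PureState l) := by
      intro k
      by_cases hk : k = i
      · subst hk
        simpa using continuous_snd
      · simpa [Function.update_of_ne hk] using continuous_fst
    have h5 : ∀ k s, Continuous fun p : PureState l × PureState l =>
        (Function.update (fun _ => p.1) i p.2 k : PureState l).1 s := fun k s =>
      (continuous_coord s).comp (h4 k)
    fun_prop
  exact ((hc.integrable_of_hasCompactSupport (HasCompactSupport.of_compactSpace _)
    (μ := (haarState l).prod (haarState l)))).integral_prod_left

/-- A single copy of a Haar random state `φ`, at a random one of `m + 1` places, together with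
copies of an independent Haar random state `χ` at the other places, is as good as `m + 1` copies
of `φ`, up to a polynomial factor and a term that is exponentially small. -/
theorem integral_haarState_copies_le (a : Str l → Ω → ℂ) (x : Ω → ι → Str l) {m : ℕ}
    (hm : Fintype.card ι = m + 1) :
    ∫ φ : PureState l, ‖∑ y, star (φ.1 y) * ∑ ω, a y ω * ∏ i, φ.1 (x ω i)‖ ^ 2 ∂haarState l ≤
      (1 / 2 : ℝ) ^ l *
        ∫ φ : PureState l, ∑ y, ‖∑ ω, a y ω * ∏ i, φ.1 (x ω i)‖ ^ 2 ∂haarState l +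
      (m + 1) * ∑ i, ∫ χ : PureState l, ∫ φ : PureState l, ‖∑ y, star (φ.1 y) * ∑ ω, a y ω *
        ∏ k, (Function.update (fun _ => χ) i φ k).1 (x ω k)‖ ^ 2 ∂haarState l ∂haarState l := by
  set D : ℝ := 2 ^ l with hD
  have hD1 : 1 ≤ D := one_le_pow₀ (by norm_num)
  have hm0 : (0 : ℝ) ≤ m := Nat.cast_nonneg m
  have hE := integral_haarState_energy a x hm
  set τ : ι → PureState l → ℂ := fun i χ =>
    ∑ ω, a (x ω i) ω * ∏ k ∈ Finset.univ.erase i, χ.1 (x ω k) with hτ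
  set J : ι → PureState l → ℝ := fun i χ => ∫ φ : PureState l, ‖∑ y, star (φ.1 y) * ∑ ω, a y ω *
        ∏ k, (Function.update (fun _ => χ) i φ k).1 (x ω k)‖ ^ 2 ∂haarState l with hJ
  set T : ℝ := ∫ φ : PureState l, ∑ y, ‖∑ ω, a y ω * ∏ i, φ.1 (x ω i)‖ ^ 2 ∂haarState l with hT
  have hT0 : 0 ≤ T := integral_nonneg fun φ => by positivity
  have hτc : ∀ i, Continuous (τ i) := fun i => by fun_prop
  -- the energy identity for a single copy bounds the partial trace `τ i χ`, which is the full trace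
  -- of an operator that depends on `χ`
  have h1 : ∀ i χ, ‖τ i χ‖ ^ 2 ≤ (D + 1) * D * J i χ := by
    intro i χ
    have h2 := integral_haarState_energy (ι := Unit)
      (fun y ω => a y ω * ∏ k ∈ Finset.univ.erase i, χ.1 (x ω k)) (fun ω _ => x ω i) (m := 0)
      (by simp)
    simp only [CharP.cast_eq_zero, zero_add, add_zero, Finset.univ_unique, PUnit.default_eq_unit,
      Finset.prod_const, Finset.card_singleton, pow_one, Finset.sum_singleton,
      Finset.erase_singleton, Finset.card_empty, pow_zero, mul_one, integral_const, probReal_univ,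
      one_smul, ← hD] at h2
    have h3 : ∀ (φ : PureState l) (y : Str l), ∑ ω, a y ω *
        ∏ k, (Function.update (fun _ => χ) i φ k).1 (x ω k) =
        ∑ ω, (a y ω * ∏ k ∈ Finset.univ.erase i, χ.1 (x ω k)) * φ.1 (x ω i) := by
      intro φ y
      refine Finset.sum_congr rfl fun ω _ => ?_
      rw [← Finset.mul_prod_erase _ _ (Finset.mem_univ i), Function.update_self]
      rw [Finset.prod_congr rfl fun k hk => by
        rw [Function.update_of_ne (Finset.ne_of_mem_erase hk)]]
      ring
    simp only [hJ, h3]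
    rw [h2]
    have : 0 ≤ D * ∫ φ : PureState l, ∑ y, ‖∑ ω, (a y ω *
        ∏ k ∈ Finset.univ.erase i, χ.1 (x ω k)) * φ.1 (x ω i)‖ ^ 2 ∂haarState l :=
      mul_nonneg (by linarith) (integral_nonneg fun φ => by positivity)
    linarith
  have hJint : ∀ i, Integrable (J i) (haarState l) := integrable_integral_copies a x
  -- Cauchy-Schwarz for the sum over the places of the single copy
  have h6 : ∫ φ : PureState l, ‖∑ i, τ i φ‖ ^ 2 ∂haarState l ≤
      (m + 1) * ∑ i, ((D + 1) * D * ∫ χ, J i χ ∂haarState l) := by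
    have h7 : ∀ φ, ‖∑ i, τ i φ‖ ^ 2 ≤ (m + 1) * ∑ i, (D + 1) * D * J i φ := by
      intro φ
      calc ‖∑ i, τ i φ‖ ^ 2 ≤ (∑ i, ‖τ i φ‖) ^ 2 := by
            gcongr
            exact norm_sum_le _ _
        _ ≤ (Finset.univ.card (α := ι) : ℝ) * ∑ i, ‖τ i φ‖ ^ 2 := sq_sum_le_card_mul_sum_sq
        _ ≤ _ := by
            rw [Finset.card_univ, hm]
            push_cast
            gcongr with i
            exact h1 i φ
    calc ∫ φ : PureState l, ‖∑ i, τ i φ‖ ^ 2 ∂haarState l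
        ≤ ∫ φ : PureState l, (m + 1) * ∑ i, (D + 1) * D * J i φ ∂haarState l :=
          integral_mono (integrable_haarState (by fun_prop))
            ((integrable_finsetSum _ fun i _ => (hJint i).const_mul _).const_mul _) h7
      _ = _ := by
          rw [integral_const_mul, integral_finsetSum _ fun i _ => (hJint i).const_mul _]
          simp_rw [integral_const_mul]
  rw [← Finset.mul_sum] at h6
  set L := ∫ φ : PureState l, ‖∑ y, star (φ.1 y) * ∑ ω, a y ω * ∏ i, φ.1 (x ω i)‖ ^ 2 ∂haarState l
  set W := ∑ i, ∫ χ, J i χ ∂haarState l with hW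
  have hW0 : 0 ≤ W := Finset.sum_nonneg fun i _ => integral_nonneg fun χ =>
    integral_nonneg fun φ => by positivity
  have hpos : 0 < (D + (m + 1)) * (D + m) := by positivity
  have h8 : (1 / 2 : ℝ) ^ l = 1 / D := by rw [hD, one_div_pow]
  rw [h8]
  have h9 : (D + (m + 1)) * (D + m) * L ≤
      (D + (m + 1)) * (D + m) * (1 / D * T + (m + 1) * W) := by
    have e1 : (D + m) * T ≤ (D + (m + 1)) * (D + m) * (1 / D * T) := by
      have : (D + (m + 1)) * (D + m) * (1 / D * T) = ((D + m) * T) * ((D + (m + 1)) / D) := by ring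
      rw [this]
      exact le_mul_of_one_le_right (by positivity) (by rw [one_le_div (by linarith)]; linarith)
    have e2 : (D + 1) * D ≤ (D + (m + 1)) * (D + m) := by
      apply mul_le_mul <;> linarith
    have e3 : (m + 1) * ((D + 1) * D * W) ≤ (D + (m + 1)) * (D + m) * ((m + 1) * W) := by
      have := mul_le_mul_of_nonneg_right e2 (show 0 ≤ (m + 1) * W by positivity)
      linarith
    rw [hE]
    linarith
  exact le_of_mul_le_mul_left h9 hpos

end Copies

/-! ### Operators on some of the wires -/

section OnWires

variable {W : Type} {k : ℕ}

theorem extend_extend (e : Fin k ↪ W) (b c : Fin k → Bool) (x : W → Bool) :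
    Function.extend e c (Function.extend e b x) = Function.extend e c x := by
  ext w
  by_cases hw : w ∈ Set.range e
  · obtain ⟨i, rfl⟩ := hw
    simp [e.injective.extend_apply]
  · simp only [Function.extend_apply' _ _ _ hw]

theorem conjTranspose_onWires (e : Fin k ↪ W) (A : Matrix (Fin k → Bool) (Fin k → Bool) ℂ) :
    (onWires e A)ᴴ = onWires e Aᴴ := by
  ext x y
  simp only [onWires, Matrix.conjTranspose_apply, Matrix.of_apply, apply_ite star, star_zero]
  classical exact if_congr (forall₂_congr fun _ _ => eq_comm) rfl rfl

variable [Fintype W] [DecidableEq W]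

/-- `Function.extend e b x` is the bit string `x` with the bits on the wires `e` replaced by `b`. -/
theorem mulVec_onWires (e : Fin k ↪ W) (A : Matrix (Fin k → Bool) (Fin k → Bool) ℂ)
    (v : (W → Bool) → ℂ) (x : W → Bool) :
    (onWires e A *ᵥ v) x = ∑ b, A (fun i => x (e i)) b * v (Function.extend e b x) := by
  rw [Matrix.mulVec, dotProduct]
  symm
  refine Finset.sum_of_injOn (fun b => Function.extend e b x) ?_ (fun _ _ => Finset.mem_univ _)
    ?_ ?_
  · intro b _ c _ hbc
    ext i
    simpa [e.injective.extend_apply] using congrFun hbc (e i)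
  · intro y _ hy
    simp only [onWires, Matrix.of_apply]
    rw [if_neg, zero_mul]
    intro h
    refine hy ⟨fun i => y (e i), Finset.mem_coe.2 (Finset.mem_univ _), ?_⟩
    ext w
    by_cases hw : w ∈ Set.range e
    · obtain ⟨i, rfl⟩ := hw
      simp [e.injective.extend_apply]
    · simp only [Function.extend_apply' _ _ _ hw, h w hw]
  · intro b _
    have h1 : ∀ w, w ∉ Set.range e → x w = Function.extend e b x w := fun w hw => by
      rw [Function.extend_apply' _ _ _ hw]
    simp only [onWires, Matrix.of_apply]
    rw [if_pos h1]
    simp [e.injective.extend_apply]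

theorem onWires_mul (e : Fin k ↪ W) (A B : Matrix (Fin k → Bool) (Fin k → Bool) ℂ) :
    onWires e A * onWires e B = onWires e (A * B) := by
  apply Matrix.mulVec_injective
  funext v
  ext x
  rw [← Matrix.mulVec_mulVec, mulVec_onWires, mulVec_onWires]
  simp_rw [mulVec_onWires, extend_extend, Matrix.mul_apply, Finset.sum_mul, Finset.mul_sum]
  rw [Finset.sum_comm]
  simp [e.injective.extend_apply, mul_assoc]

theorem onWires_one (e : Fin k ↪ W) : onWires e 1 = 1 := by
  apply Matrix.mulVec_injective
  funext v
  ext x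
  rw [mulVec_onWires, Matrix.one_mulVec]
  simp only [Matrix.one_apply, ite_mul, one_mul, zero_mul, Finset.sum_ite_eq, Finset.mem_univ,
    if_true]
  congr 1
  ext w
  by_cases hw : w ∈ Set.range e
  · obtain ⟨i, rfl⟩ := hw
    simp [e.injective.extend_apply]
  · simp only [Function.extend_apply' _ _ _ hw]

theorem onWires_isometry (e : Fin k ↪ W) {A : Matrix (Fin k → Bool) (Fin k → Bool) ℂ}
    (hA : Aᴴ * A = 1) : (onWires e A)ᴴ * onWires e A = 1 := by
  rw [conjTranspose_onWires, onWires_mul, hA, onWires_one]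

/-- Operators on wires inside the range of `ι` act on the corresponding tensor factor only; `f` is
the state of the other wires. -/
theorem onWires_trans_mulVec {W' : Type} [Fintype W'] [DecidableEq W'] (ι : W ↪ W')
    (e : Fin k ↪ W) (A : Matrix (Fin k → Bool) (Fin k → Bool) ℂ) (u : (W → Bool) → ℂ)
    (f : (W' → Bool) → ℂ)
    (hf : ∀ z z' : W' → Bool, (∀ w, w ∉ Set.range ι → z w = z' w) → f z = f z') :
    onWires (e.trans ι) A *ᵥ (fun z => u (fun w => z (ι w)) * f z) =
      fun z => (onWires e A *ᵥ u) (fun w => z (ι w)) * f z := by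
  ext z
  rw [mulVec_onWires, mulVec_onWires, Finset.sum_mul]
  refine Finset.sum_congr rfl fun b _ => ?_
  rw [hf (Function.extend (e.trans ι) b z) z fun w hw => Function.extend_apply' _ _ _
    fun ⟨i, hi⟩ => hw ⟨e i, hi⟩, mul_assoc]
  congr 3
  ext w
  by_cases hw : w ∈ Set.range e
  · obtain ⟨i, rfl⟩ := hw
    rw [e.injective.extend_apply]
    exact (e.trans ι).injective.extend_apply _ _ i
  · rw [Function.extend_apply' _ _ _ hw, Function.extend_apply']
    rintro ⟨i, hi⟩
    exact hw ⟨i, ι.injective hi⟩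

end OnWires

section Gates

theorem hadamardBit_isometry : hadamardBitᴴ * hadamardBit = 1 := by
  have h2 : ((Real.sqrt 2 : ℝ) : ℂ) * (Real.sqrt 2 : ℝ) = 2 := by
    rw [← Complex.ofReal_mul, Real.mul_self_sqrt (by norm_num)]
    norm_num
  have h0 : ((Real.sqrt 2 : ℝ) : ℂ) ≠ 0 := by
    intro h
    rw [h] at h2
    norm_num at h2
  ext a b
  cases a <;> cases b <;>
    simp [Matrix.mul_apply, hadamardBit, Complex.conj_ofReal] <;> field_simp <;>
    first | ring1 | linear_combination -h2

variable {W : Type} [Fintype W] [DecidableEq W]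

theorem Gate.matrix_isometry (g : Gate W) : g.matrixᴴ * g.matrix = 1 := by
  cases g with
  | hadamard w =>
    refine onWires_isometry w ?_
    have h := congrArg (fun M : Matrix Bool Bool ℂ =>
      M.submatrix (Equiv.funUnique (Fin 1) Bool) (Equiv.funUnique (Fin 1) Bool))
      hadamardBit_isometry
    rw [← Matrix.submatrix_mul_equiv _ _ _ (Equiv.funUnique (Fin 1) Bool) _,
      Matrix.submatrix_one_equiv] at h
    exact h
  | phaseT w =>
    refine onWires_isometry w ?_
    rw [Matrix.diagonal_conjTranspose, Matrix.diagonal_mul_diagonal, Matrix.diagonal_eq_one]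
    ext x
    simp only [Pi.star_apply, Pi.one_apply]
    split_ifs
    · rw [Complex.star_def, ← Complex.exp_conj, ← Complex.exp_add, map_mul, Complex.conj_I,
        Complex.conj_ofReal, neg_mul, neg_add_cancel, Complex.exp_zero]
    · simp
  | cnot w =>
    refine onWires_isometry w ?_
    ext x y
    have h : ∀ z x : Fin 2 → Bool, (z 0 = x 0 ∧ z 1 = xor (x 0) (x 1)) ↔
        z = ![x 0, xor (x 0) (x 1)] := by
      intro z x
      rw [funext_iff, Fin.forall_fin_two]
      rfl
    simp only [Matrix.mul_apply, Matrix.conjTranspose_apply, Matrix.of_apply, h, Matrix.one_apply,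
      apply_ite star, star_one, star_zero, ite_mul, one_mul, zero_mul, Finset.sum_ite_eq',
      Finset.mem_univ, if_true]
    congr 1
    revert x y
    decide

theorem cnot_mulVec (w : Fin 2 ↪ W) (v : (W → Bool) → ℂ) :
    (Gate.cnot w).matrix *ᵥ v =
      fun x => v (Function.update x (w 1) (xor (x (w 0)) (x (w 1)))) := by
  ext x
  have h : ∀ z : Fin 2 → Bool, (x (w 0) = z 0 ∧ x (w 1) = xor (z 0) (z 1)) ↔
      z = ![x (w 0), xor (x (w 0)) (x (w 1))] := by
    intro z
    rw [funext_iff, Fin.forall_fin_two]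
    simp only [Matrix.cons_val_zero, Matrix.cons_val_one]
    generalize x (w 0) = a
    generalize x (w 1) = b
    generalize z 0 = c
    generalize z 1 = d
    revert a b c d
    decide
  rw [Gate.matrix, mulVec_onWires]
  simp only [Matrix.of_apply, h, ite_mul, one_mul, zero_mul, Finset.sum_ite_eq', Finset.mem_univ,
    if_true]
  congr 1
  ext u
  by_cases hu : u ∈ Set.range w
  · obtain ⟨i, rfl⟩ := hu
    rw [w.injective.extend_apply]
    revert i
    rw [Fin.forall_fin_two]
    refine ⟨?_, ?_⟩
    · rw [Function.update_of_ne (w.injective.ne (by decide))]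
      rfl
    · rw [Function.update_self]
      rfl
  · rw [Function.extend_apply' _ _ _ hu, Function.update_of_ne]
    rintro rfl
    exact hu ⟨1, rfl⟩

theorem LearnStep.matrix_isometry {l : ℕ} (U : Matrix.unitaryGroup (Str l) ℂ)
    (g : LearnStep l W) : (g.matrix U)ᴴ * g.matrix U = 1 := by
  cases g with
  | gate g => exact g.matrix_isometry
  | query e => exact onWires_isometry e (Matrix.mem_unitaryGroup_iff'.1 U.2)

end Gates

section Relabel

variable {W W' : Type}

/-- The gate acts on the wires `ι w` instead of `w`. -/
def Gate.relabel (ι : W ↪ W') : Gate W → Gate W'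
  | .hadamard w => .hadamard (w.trans ι)
  | .phaseT w => .phaseT (w.trans ι)
  | .cnot w => .cnot (w.trans ι)

/-- The learning step acts on the wires `ι w` instead of `w`. -/
def LearnStep.relabel {l : ℕ} (ι : W ↪ W') : LearnStep l W → LearnStep l W'
  | .gate g => .gate (g.relabel ι)
  | .query e => .query (e.trans ι)

variable [Fintype W] [DecidableEq W] [Fintype W'] [DecidableEq W']

theorem Gate.relabel_mulVec (ι : W ↪ W') (g : Gate W) (u : (W → Bool) → ℂ)
    (f : (W' → Bool) → ℂ)
    (hf : ∀ z z' : W' → Bool, (∀ w, w ∉ Set.range ι → z w = z' w) → f z = f z') :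
    (g.relabel ι).matrix *ᵥ (fun z => u (fun w => z (ι w)) * f z) =
      fun z => (g.matrix *ᵥ u) (fun w => z (ι w)) * f z := by
  cases g <;> exact onWires_trans_mulVec ι _ _ u f hf

theorem LearnStep.relabel_mulVec {l : ℕ} (U : Matrix.unitaryGroup (Str l) ℂ) (ι : W ↪ W')
    (g : LearnStep l W) (u : (W → Bool) → ℂ) (f : (W' → Bool) → ℂ)
    (hf : ∀ z z' : W' → Bool, (∀ w, w ∉ Set.range ι → z w = z' w) → f z = f z') :
    (g.relabel ι).matrix U *ᵥ (fun z => u (fun w => z (ι w)) * f z) =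
      fun z => (g.matrix U *ᵥ u) (fun w => z (ι w)) * f z := by
  cases g with
  | gate g => exact g.relabel_mulVec ι u f hf
  | query e => exact onWires_trans_mulVec ι _ _ u f hf

theorem foldl_gate_relabel (ι : W ↪ W') (f : (W' → Bool) → ℂ)
    (hf : ∀ z z' : W' → Bool, (∀ w, w ∉ Set.range ι → z w = z' w) → f z = f z')
    (gs : List (Gate W)) (u : (W → Bool) → ℂ) :
    (gs.map (Gate.relabel ι)).foldl (fun v g => g.matrix *ᵥ v)
        (fun z => u (fun w => z (ι w)) * f z) =
      fun z => gs.foldl (fun v g => g.matrix *ᵥ v) u (fun w => z (ι w)) * f z := by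
  induction gs generalizing u with
  | nil => rfl
  | cons g gs ih =>
    rw [List.map_cons, List.foldl_cons, List.foldl_cons, g.relabel_mulVec ι u f hf, ih]

theorem foldl_learnStep_relabel {l : ℕ} (U : Matrix.unitaryGroup (Str l) ℂ) (ι : W ↪ W')
    (f : (W' → Bool) → ℂ)
    (hf : ∀ z z' : W' → Bool, (∀ w, w ∉ Set.range ι → z w = z' w) → f z = f z')
    (gs : List (LearnStep l W)) (u : (W → Bool) → ℂ) :
    (gs.map (LearnStep.relabel ι)).foldl (fun v g => g.matrix U *ᵥ v)
        (fun z => u (fun w => z (ι w)) * f z) =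
      fun z => gs.foldl (fun v g => g.matrix U *ᵥ v) u (fun w => z (ι w)) * f z := by
  induction gs generalizing u with
  | nil => rfl
  | cons g gs ih =>
    rw [List.map_cons, List.foldl_cons, List.foldl_cons, g.relabel_mulVec U ι u f hf, ih]

end Relabel

/-! ### Swapping two registers with CNOT gates -/

section SwapRegisters

variable {W : Type} [Fintype W] [DecidableEq W]

/-- An ordered pair of distinct wires. -/
def wirePair (a b : W) (h : a ≠ b) : Fin 2 ↪ W :=
  ⟨![a, b], by
    intro i j hij
    revert i j
    simp [Fin.forall_fin_two, h, h.symm]⟩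

/-- Three CNOT gates that exchange two qubits. -/
def swapGates (a b : W) (h : a ≠ b) : List (Gate W) :=
  [.cnot (wirePair a b h), .cnot (wirePair b a h.symm), .cnot (wirePair a b h)]

theorem foldl_swapGates (a b : W) (h : a ≠ b) (v : (W → Bool) → ℂ) :
    (swapGates a b h).foldl (fun v g => g.matrix *ᵥ v) v =
      fun x => v (fun w => x (Equiv.swap a b w)) := by
  simp only [swapGates, List.foldl_cons, List.foldl_nil, cnot_mulVec]
  ext x
  congr 1
  have e0 : ∀ (a b : W) (h : a ≠ b), wirePair a b h 0 = a := fun _ _ _ => rfl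
  have e1 : ∀ (a b : W) (h : a ≠ b), wirePair a b h 1 = b := fun _ _ _ => rfl
  simp only [e0, e1]
  ext w
  by_cases hb : w = b
  · subst hb
    simp [h, h.symm, Function.update_of_ne]
  · by_cases ha : w = a
    · subst ha
      simp [h, h.symm, Function.update_of_ne]
      generalize x b = p
      generalize x w = q
      revert p q
      decide
    · simp [ha, hb, Equiv.swap_apply_of_ne_of_ne, Function.update_of_ne]

variable {n l : ℕ} {R : Type} [DecidableEq R]

/-- CNOT gates that exchange the registers of the rounds `r` and `s`, qubit by qubit. -/
def swapRegisterGates (n l : ℕ) (r s : R) : List (Gate (Fin n ⊕ R × Fin l)) :=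
  if h : r = s then [] else
    (List.finRange l).flatMap fun k => swapGates (Sum.inr (r, k)) (Sum.inr (s, k))
      (by simpa using h)

theorem length_swapRegisterGates_le (r s : R) : (swapRegisterGates n l r s).length ≤ 3 * l := by
  unfold swapRegisterGates
  split_ifs
  · simp
  · simp [List.length_flatMap, swapGates, mul_comm]

variable [Fintype R]

theorem foldl_swapRegisterGates (r s : R) (v : (Fin n ⊕ R × Fin l → Bool) → ℂ) :
    (swapRegisterGates n l r s).foldl (fun v g => g.matrix *ᵥ v) v =
      fun x => v (Sum.elim (fun w => x (Sum.inl w))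
        fun p => x (Sum.inr (Equiv.swap r s p.1, p.2))) := by
  unfold swapRegisterGates
  split_ifs with h
  · subst h
    ext x
    simp only [List.foldl_nil, Equiv.swap_self, Equiv.refl_apply]
    congr 1
    ext w
    cases w <;> rfl
  · have key : ∀ (ks : List (Fin l)), ks.Nodup → ∀ v : (Fin n ⊕ R × Fin l → Bool) → ℂ,
        (ks.flatMap fun k => swapGates (Sum.inr (r, k)) (Sum.inr (s, k))
          (by simpa using h)).foldl (fun v g => g.matrix *ᵥ v) v =
        fun x => v (Sum.elim (fun w => x (Sum.inl w))
          fun p => x (Sum.inr (if p.2 ∈ ks then Equiv.swap r s p.1 else p.1, p.2))) := by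
      intro ks hks
      induction ks with
      | nil =>
        intro v
        ext x
        simp only [List.flatMap_nil, List.foldl_nil, List.not_mem_nil, if_false]
        congr 1
        ext w
        cases w <;> rfl
      | cons k ks ih =>
        intro v
        rw [List.flatMap_cons, List.foldl_append, foldl_swapGates, ih (List.nodup_cons.1 hks).2]
        ext x
        congr 1
        ext w
        rcases w with w | ⟨q, j⟩
        · rw [Equiv.swap_apply_of_ne_of_ne (by simp) (by simp)]
          rfl
        · by_cases hj : j = k
          · subst hj
            have hnot := (List.nodup_cons.1 hks).1
            by_cases h1 : q = r
            · subst h1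
              simp [hnot]
            · by_cases h2 : q = s
              · subst h2
                simp [hnot]
              · rw [Equiv.swap_apply_of_ne_of_ne (by simp [h1]) (by simp [h2])]
                simp [Equiv.swap_apply_of_ne_of_ne h1 h2]
          · rw [Equiv.swap_apply_of_ne_of_ne (by simp [hj]) (by simp [hj])]
            simp [hj]
    rw [key _ (List.nodup_finRange l)]
    simp

end SwapRegisters

/-! ### Replies, marginals and fidelities -/

section Isometry

theorem sum_norm_sq_mulVec {m n : Type} [Fintype m] [Fintype n] [DecidableEq n]
    {G : Matrix m n ℂ} (hG : Gᴴ * G = 1) (v : n → ℂ) :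
    ∑ x, ‖(G *ᵥ v) x‖ ^ 2 = ∑ x, ‖v x‖ ^ 2 := by
  have h : ∀ {k : Type} [Fintype k] (u : k → ℂ), ((∑ x, ‖u x‖ ^ 2 : ℝ) : ℂ) = star u ⬝ᵥ u := by
    intro k _ u
    rw [dotProduct]
    push_cast
    refine Finset.sum_congr rfl fun x _ => ?_
    rw [Pi.star_apply, Complex.star_def, Complex.conj_mul']
  apply Complex.ofReal_injective
  rw [h, h, Matrix.star_mulVec, Matrix.dotProduct_mulVec, Matrix.vecMul_vecMul, hG,
    Matrix.vecMul_one]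

/-- The steps of a circuit multiply to one isometry. -/
theorem exists_foldl_mulVec {n α : Type} [Fintype n] [DecidableEq n] (f : α → Matrix n n ℂ)
    (hf : ∀ a, (f a)ᴴ * f a = 1) (L : List α) :
    ∃ G : Matrix n n ℂ, Gᴴ * G = 1 ∧ ∀ v, L.foldl (fun v a => f a *ᵥ v) v = G *ᵥ v := by
  induction L with
  | nil => exact ⟨1, by simp, fun v => by simp⟩
  | cons a L ih =>
    obtain ⟨G, hG, h⟩ := ih
    refine ⟨G * f a, ?_, fun v => ?_⟩
    · rw [Matrix.conjTranspose_mul, Matrix.mul_assoc, ← Matrix.mul_assoc Gᴴ, hG, Matrix.one_mul,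
        hf]
    · rw [List.foldl_cons, h, Matrix.mulVec_mulVec]

theorem sum_norm_sq_pureState {l : ℕ} (φ : PureState l) : ∑ x, ‖φ.1 x‖ ^ 2 = 1 := by
  rw [← EuclideanSpace.norm_sq_eq, norm_eq_of_mem_sphere, one_pow]

theorem sum_norm_sq_response {l : ℕ} (U : Matrix.unitaryGroup (Str l) ℂ) (φ : PureState l) :
    ∑ x, ‖response U φ x‖ ^ 2 = 1 := by
  rw [response, sum_norm_sq_mulVec (Matrix.mem_unitaryGroup_iff'.1 U.2), sum_norm_sq_pureState]

end Isometry

section Marginal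

variable {l : ℕ} {R : Type} [DecidableEq R]

/-- The string that is `a` in the register `r` and `e` in the other registers. -/
def glue (r : R) (a : Str l) (e : {q // q ≠ r} → Str l) : R → Str l :=
  (Equiv.funSplitAt r (Str l)).symm (a, e)

theorem glue_self (r : R) (a : Str l) (e : {q // q ≠ r} → Str l) : glue r a e r = a := by
  simp [glue]

theorem glue_of_ne (r : R) (a : Str l) (e : {q // q ≠ r} → Str l) {q : R} (h : q ≠ r) :
    glue r a e q = e ⟨q, h⟩ := by
  simp [glue, h]

theorem update_glue (r : R) (a b : Str l) (e : {q // q ≠ r} → Str l) :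
    Function.update (glue r a e) r b = glue r b e := by
  ext1 q
  by_cases h : q = r
  · subst h
    rw [Function.update_self, glue_self]
  · rw [Function.update_of_ne h, glue_of_ne _ _ _ h, glue_of_ne _ _ _ h]

variable [Fintype R]

theorem sum_glue {A : Type} [AddCommMonoid A] (r : R) (f : (R → Str l) → A) :
    ∑ e, ∑ a, f (glue r a e) = ∑ x, f x := by
  rw [← (Equiv.funSplitAt r (Str l)).symm.sum_comp, Fintype.sum_prod_type_right]
  rfl

theorem marginal_apply (ρ : Matrix (R → Str l) (R → Str l) ℂ) (r : R) (a b : Str l) :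
    marginal ρ r a b = ∑ e, ρ (glue r a e) (glue r b e) := by
  rw [marginal, Matrix.of_apply, ← sum_glue r]
  refine Finset.sum_congr rfl fun e _ => ?_
  simp [glue_self, update_glue]

theorem marginal_eq_sum_submatrix (ρ : Matrix (R → Str l) (R → Str l) ℂ) (r : R) :
    marginal ρ r = ∑ e, ρ.submatrix (fun a => glue r a e) (fun a => glue r a e) := by
  ext a b
  rw [marginal_apply, Matrix.sum_apply]
  rfl

theorem posSemidef_marginal {ρ : Matrix (R → Str l) (R → Str l) ℂ} (hρ : ρ.PosSemidef) (r : R) :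
    (marginal ρ r).PosSemidef := by
  rw [marginal_eq_sum_submatrix]
  exact Matrix.posSemidef_sum _ fun e _ => hρ.submatrix _

theorem fidelity_sq {σ : Matrix (Str l) (Str l) ℂ} (hσ : σ.PosSemidef) (ψ : Str l → ℂ) :
    fidelity σ ψ ^ 2 = (star ψ ⬝ᵥ (σ *ᵥ ψ)).re := by
  rw [fidelity, Real.sq_sqrt]
  exact (Complex.le_def.1 (hσ.dotProduct_mulVec_nonneg ψ)).1

theorem fidelity_nonneg (σ : Matrix (Str l) (Str l) ℂ) (ψ : Str l → ℂ) : 0 ≤ fidelity σ ψ :=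
  Real.sqrt_nonneg _

end Marginal

section Reply

theorem Adversary.sum_norm_sq_learned {l : ℕ} {R : Type} (E : Adversary l R)
    (U : Matrix.unitaryGroup (Str l) ℂ) : ∑ z, ‖E.learned U z‖ ^ 2 = 1 := by
  obtain ⟨G, hG, h⟩ := exists_foldl_mulVec (fun g : LearnStep l (Fin E.work) => g.matrix U)
    (LearnStep.matrix_isometry U) E.learn
  rw [Adversary.learned, h, sum_norm_sq_mulVec hG, E.advice_norm]

variable {l n : ℕ} {R : Type} [Fintype R] [DecidableEq R]

/-- The joint state of all wires, given the state `u` of the work qubits and the contents `φ` of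
the challenge registers. -/
noncomputable def startState (u : Str n → ℂ) (φ : R → PureState l) :
    (Fin n ⊕ R × Fin l → Bool) → ℂ :=
  fun x => u (fun w => x (Sum.inl w)) * ∏ r, (φ r).1 (fun k => x (Sum.inr (r, k)))

/-- A basis state of all wires is one of the work qubits and one of each register. -/
def wiresEquiv (n l : ℕ) (R : Type) : Str n × (R → Str l) ≃ (Fin n ⊕ R × Fin l → Bool) where
  toFun p := Sum.elim p.1 fun q => p.2 q.1 q.2
  invFun x := (fun w => x (Sum.inl w), fun r k => x (Sum.inr (r, k)))
  left_inv _ := rfl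
  right_inv x := by
    ext w
    cases w <;> rfl

theorem sum_wires {A : Type} [AddCommMonoid A] (f : (Fin n ⊕ R × Fin l → Bool) → A) :
    ∑ z : Str n, ∑ x : R → Str l, f (Sum.elim z fun q => x q.1 q.2) = ∑ y, f y := by
  rw [← (wiresEquiv n l R).sum_comp, Fintype.sum_prod_type]
  rfl

theorem sum_norm_sq_startState (u : Str n → ℂ) (φ : R → PureState l) :
    ∑ x, ‖startState u φ x‖ ^ 2 = ∑ z, ‖u z‖ ^ 2 := by
  rw [← sum_wires]
  refine Finset.sum_congr rfl fun z _ => ?_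
  have h : ∑ x : R → Str l, ∏ r, ‖(φ r).1 (x r)‖ ^ 2 = 1 := by
    rw [← Fintype.piFinset_univ, ← Finset.prod_univ_sum (fun _ => Finset.univ)
      (fun r a => ‖(φ r).1 a‖ ^ 2)]
    exact Finset.prod_eq_one fun r _ => sum_norm_sq_pureState (φ r)
  simp only [startState, Sum.elim_inl, Sum.elim_inr, norm_mul, norm_prod, mul_pow,
    ← Finset.prod_pow]
  rw [← Finset.mul_sum, h, mul_one]

variable (E : Adversary l R) (U : Matrix.unitaryGroup (Str l) ℂ) (φ : R → PureState l)

/-- The attack circuit is an isometry that does not depend on the device or the challenges. -/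
theorem Adversary.exists_attack_isometry : ∃ G : Matrix (Fin E.work ⊕ R × Fin l → Bool)
    (Fin E.work ⊕ R × Fin l → Bool) ℂ, Gᴴ * G = 1 ∧
      ∀ U φ, E.final U φ = G *ᵥ startState (E.learned U) φ := by
  obtain ⟨G, hG, h⟩ := exists_foldl_mulVec (fun g : Gate (Fin E.work ⊕ R × Fin l) => g.matrix)
    Gate.matrix_isometry E.attack
  exact ⟨G, hG, fun U φ => h _⟩

theorem Adversary.sum_norm_sq_final : ∑ x, ‖E.final U φ x‖ ^ 2 = 1 := by
  obtain ⟨G, hG, h⟩ := E.exists_attack_isometry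
  rw [h, sum_norm_sq_mulVec hG, sum_norm_sq_startState, E.sum_norm_sq_learned]

theorem Adversary.reply_eq_sum : E.reply U φ = ∑ z : Str E.work,
    Matrix.vecMulVec (fun x : R → Str l => E.final U φ (Sum.elim z fun p => x p.1 p.2))
      (star fun x : R → Str l => E.final U φ (Sum.elim z fun p => x p.1 p.2)) := by
  ext x y
  rw [Matrix.sum_apply]
  rfl

theorem Adversary.posSemidef_reply : (E.reply U φ).PosSemidef := by
  rw [E.reply_eq_sum]
  exact Matrix.posSemidef_sum _ fun z _ => Matrix.posSemidef_vecMulVec_self_star _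

theorem Adversary.trace_reply : (E.reply U φ).trace = 1 := by
  have h : ((∑ x, ‖E.final U φ x‖ ^ 2 : ℝ) : ℂ) = 1 := by
    rw [E.sum_norm_sq_final, Complex.ofReal_one]
  rw [← h, ← sum_wires, Matrix.trace, Finset.sum_comm]
  push_cast
  refine Finset.sum_congr rfl fun x _ => ?_
  rw [Matrix.diag_apply, Adversary.reply, Matrix.of_apply]
  refine Finset.sum_congr rfl fun z _ => ?_
  rw [Complex.star_def, Complex.mul_conj']

/-- The squared fidelity is the total weight of the components of the final state along `ψ` in the
register `r`, over the basis states of the work qubits and the other registers. -/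
theorem Adversary.fidelity_marginal_reply_sq (r : R) (ψ : Str l → ℂ) :
    fidelity (marginal (E.reply U φ) r) ψ ^ 2 = ∑ z : Str E.work, ∑ e : {q // q ≠ r} → Str l,
      ‖∑ a, star (ψ a) * E.final U φ (Sum.elim z fun p => glue r a e p.1 p.2)‖ ^ 2 := by
  rw [fidelity_sq (posSemidef_marginal (E.posSemidef_reply U φ) r)]
  have h : star ψ ⬝ᵥ (marginal (E.reply U φ) r *ᵥ ψ) =
      ((∑ z : Str E.work, ∑ e : {q // q ≠ r} → Str l,
      ‖∑ a, star (ψ a) * E.final U φ (Sum.elim z fun p => glue r a e p.1 p.2)‖ ^ 2 : ℝ) : ℂ) := by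
    have hsq : ∀ z : ℂ, ((‖z‖ : ℝ) : ℂ) ^ 2 = z * star z := fun z => by
      rw [Complex.star_def, Complex.mul_conj']
    push_cast
    simp_rw [hsq, star_sum, star_mul', star_star, Finset.sum_mul_sum]
    simp only [dotProduct, Matrix.mulVec, Pi.star_apply, marginal_apply, Adversary.reply,
      Matrix.of_apply, Finset.sum_mul, Finset.mul_sum]
    -- the sum over the work qubits and the other registers is moved to the front
    rw [Finset.sum_congr rfl fun a _ => Finset.sum_congr rfl fun b _ => Finset.sum_comm]
    rw [Finset.sum_congr rfl fun a _ => Finset.sum_comm, Finset.sum_comm]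
    refine Finset.sum_congr rfl fun z _ => ?_
    rw [Finset.sum_congr rfl fun a _ => Finset.sum_comm, Finset.sum_comm]
    refine Finset.sum_congr rfl fun e _ => Finset.sum_congr rfl fun a _ =>
      Finset.sum_congr rfl fun b _ => ?_
    ring
  rw [h, Complex.ofReal_re]

theorem norm_sum_mul_sq_le {n : Type} [Fintype n] (f g : n → ℂ) :
    ‖∑ a, f a * g a‖ ^ 2 ≤ (∑ a, ‖f a‖ ^ 2) * ∑ a, ‖g a‖ ^ 2 :=
  calc ‖∑ a, f a * g a‖ ^ 2 ≤ (∑ a, ‖f a‖ * ‖g a‖) ^ 2 := by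
        gcongr
        exact (norm_sum_le _ _).trans_eq (Finset.sum_congr rfl fun a _ => norm_mul _ _)
    _ ≤ _ := Finset.sum_mul_sq_le_sq_mul_sq _ _ _

theorem Adversary.fidelity_marginal_reply_sq_le_one (r : R) {ψ : Str l → ℂ}
    (hψ : ∑ a, ‖ψ a‖ ^ 2 = 1) : fidelity (marginal (E.reply U φ) r) ψ ^ 2 ≤ 1 := by
  rw [E.fidelity_marginal_reply_sq]
  calc _ ≤ ∑ z : Str E.work, ∑ e : {q // q ≠ r} → Str l,
        ∑ a, ‖E.final U φ (Sum.elim z fun p => glue r a e p.1 p.2)‖ ^ 2 := by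
        refine Finset.sum_le_sum fun z _ => Finset.sum_le_sum fun e _ => ?_
        refine (norm_sum_mul_sq_le _ _).trans_eq ?_
        simp only [norm_star, hψ, one_mul]
    _ = ∑ z : Str E.work, ∑ x : R → Str l,
        ‖E.final U φ (Sum.elim z fun p => x p.1 p.2)‖ ^ 2 := by
        refine Finset.sum_congr rfl fun z _ => ?_
        exact sum_glue r fun x => ‖E.final U φ (Sum.elim z fun p => x p.1 p.2)‖ ^ 2
    _ = 1 := by rw [sum_wires fun y => ‖E.final U φ y‖ ^ 2, E.sum_norm_sq_final]

end Reply

section Measurability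

variable {l : ℕ} {R X : Type} [MeasurableSpace X]

theorem measurable_mulVec {m n : Type} [Fintype n] {A : X → Matrix m n ℂ} {v : X → n → ℂ}
    (hA : ∀ i j, Measurable fun ω => A ω i j) (hv : ∀ j, Measurable fun ω => v ω j) (i : m) :
    Measurable fun ω => (A ω *ᵥ v ω) i := by
  simp only [Matrix.mulVec, dotProduct]
  exact Finset.measurable_sum _ fun j _ => (hA i j).mul (hv j)

theorem measurable_unitary_entry {U : X → Matrix.unitaryGroup (Str l) ℂ} (hU : Measurable U)
    (i j : Str l) : Measurable fun ω => (U ω).1 i j := by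
  have h : Continuous fun V : Matrix.unitaryGroup (Str l) ℂ => V.1 i j :=
    continuous_subtype_val.matrix_elem i j
  exact h.measurable.comp hU

theorem measurable_coord {φ : X → PureState l} (hφ : Measurable φ) (s : Str l) :
    Measurable fun ω => (φ ω).1 s :=
  (continuous_coord s).measurable.comp hφ

theorem measurable_response {U : X → Matrix.unitaryGroup (Str l) ℂ} (hU : Measurable U)
    {φ : X → PureState l} (hφ : Measurable φ) (s : Str l) :
    Measurable fun ω => response (U ω) (φ ω) s :=
  measurable_mulVec (measurable_unitary_entry hU) (measurable_coord hφ) s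

theorem Adversary.measurable_learned (E : Adversary l R)
    {U : X → Matrix.unitaryGroup (Str l) ℂ} (hU : Measurable U) (z : Str E.work) :
    Measurable fun ω => E.learned (U ω) z := by
  have h : ∀ (L : List (LearnStep l (Fin E.work))) (v : X → Str E.work → ℂ),
      (∀ z, Measurable fun ω => v ω z) →
      ∀ z, Measurable fun ω => L.foldl (fun v s => s.matrix (U ω) *ᵥ v) (v ω) z := by
    intro L
    induction L with
    | nil => exact fun v hv => hv
    | cons s L ih =>
      intro v hv
      refine ih (fun ω => s.matrix (U ω) *ᵥ v ω) fun z => measurable_mulVec (fun i j => ?_) hv z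
      cases s with
      | gate g => exact measurable_const
      | query e =>
        simp only [LearnStep.matrix, onWires, Matrix.of_apply]
        split_ifs
        · exact measurable_unitary_entry hU _ _
        · exact measurable_const
  exact h E.learn (fun _ => E.advice) (fun z => measurable_const) z

variable [Fintype R] [DecidableEq R]

theorem Adversary.measurable_final (E : Adversary l R)
    {U : X → Matrix.unitaryGroup (Str l) ℂ} (hU : Measurable U)
    {φ : X → R → PureState l} (hφ : ∀ r, Measurable fun ω => φ ω r)
    (x : Fin E.work ⊕ R × Fin l → Bool) :
    Measurable fun ω => E.final (U ω) (φ ω) x := by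
  obtain ⟨G, -, h⟩ := E.exists_attack_isometry
  simp only [h]
  refine measurable_mulVec (A := fun _ => G) (v := fun ω => startState (E.learned (U ω)) (φ ω))
    (fun i j => measurable_const) (fun y => ?_) x
  simp only [startState]
  exact (E.measurable_learned hU _).mul
    (Finset.measurable_prod Finset.univ fun r _ => measurable_coord (hφ r) _)

theorem Adversary.measurable_reply (E : Adversary l R)
    {U : X → Matrix.unitaryGroup (Str l) ℂ} (hU : Measurable U)
    {φ : X → R → PureState l} (hφ : ∀ r, Measurable fun ω => φ ω r)
    (x y : R → Str l) :
    Measurable fun ω => E.reply (U ω) (φ ω) x y := by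
  simp only [Adversary.reply, Matrix.of_apply]
  exact Finset.measurable_sum _ fun z _ => (E.measurable_final hU hφ _).mul
    (continuous_star.measurable.comp (E.measurable_final hU hφ _))

theorem Adversary.measurable_fidelity (E : Adversary l R)
    {U : X → Matrix.unitaryGroup (Str l) ℂ} (hU : Measurable U)
    {φ : X → R → PureState l} (hφ : ∀ r, Measurable fun ω => φ ω r)
    {ψ : X → Str l → ℂ}
    (hψ : ∀ s, Measurable fun ω => ψ ω s) (r : R) :
    Measurable fun ω => fidelity (marginal (E.reply (U ω) (φ ω)) r) (ψ ω) := by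
  have h1 : Measurable fun ω => star (ψ ω) ⬝ᵥ (marginal (E.reply (U ω) (φ ω)) r *ᵥ ψ ω) := by
    simp only [dotProduct]
    refine Finset.measurable_sum _ fun a _ => (continuous_star.measurable.comp (hψ a)).mul
      (measurable_mulVec (fun i j => ?_) hψ a)
    simp only [marginal_apply]
    exact Finset.measurable_sum _ fun e _ => E.measurable_reply hU hφ _ _
  exact (Complex.measurable_re.comp h1).sqrt

end Measurability

/-! ### Answering one challenge with an adversary for many rounds -/

section Single

variable {l n : ℕ} {R : Type} [Fintype R] [DecidableEq R]

/-- The wires other than those of the register `r`, as wires of a work register. -/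
noncomputable def spareEquiv (n l : ℕ) (r : R) : Fin n ⊕ {q // q ≠ r} × Fin l ≃
    Fin (Fintype.card (Fin n ⊕ {q // q ≠ r} × Fin l)) :=
  Fintype.equivFin _

/-- The wires of a protocol with rounds `R`, as wires of a single-round protocol: the register `r`
becomes the challenge register, and the other registers join the work qubits. -/
noncomputable def wireEquiv (n l : ℕ) (r : R) : Fin n ⊕ R × Fin l ≃
    Fin (Fintype.card (Fin n ⊕ {q // q ≠ r} × Fin l)) ⊕ Unit × Fin l where
  toFun
    | .inl w => .inl (spareEquiv n l r (.inl w))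
    | .inr (q, k) => if h : q = r then .inr ((), k) else .inl (spareEquiv n l r (.inr (⟨q, h⟩, k)))
  invFun
    | .inl i => match (spareEquiv n l r).symm i with
      | .inl w => .inl w
      | .inr (q, k) => .inr (q.1, k)
    | .inr (_, k) => .inr (r, k)
  left_inv := by
    rintro (w | ⟨q, k⟩)
    · simp
    · by_cases h : q = r
      · subst h
        simp
      · simp [h]
  right_inv := by
    rintro (i | ⟨_, k⟩)
    · obtain ⟨w, rfl⟩ := (spareEquiv n l r).surjective i
      rcases w with w | ⟨q, k⟩
      · simp
      · simp [q.2]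
    · simp

theorem wireEquiv_inl (r : R) (w : Fin n) :
    wireEquiv n l r (.inl w) = .inl (spareEquiv n l r (.inl w)) := rfl

theorem wireEquiv_inr_self (r : R) (k : Fin l) :
    wireEquiv n l r (.inr (r, k)) = .inr ((), k) := by
  simp [wireEquiv]

theorem wireEquiv_inr_of_ne (r : R) {q : R} (h : q ≠ r) (k : Fin l) :
    wireEquiv n l r (.inr (q, k)) = .inl (spareEquiv n l r (.inr (⟨q, h⟩, k))) := by
  simp [wireEquiv, h]

/-- The work qubits of the adversary `E`, among the work qubits of the single-round adversary. -/
noncomputable def workEmbedding (n l : ℕ) (r : R) :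
    Fin n ↪ Fin (Fintype.card (Fin n ⊕ {q // q ≠ r} × Fin l)) :=
  ⟨fun w => spareEquiv n l r (.inl w), (spareEquiv n l r).injective.comp Sum.inl_injective⟩

/-- Basis states of the work qubits of the single-round adversary, and basis states of the work
qubits of the given adversary and of the registers other than `r`. -/
noncomputable def spareStrEquiv (n l : ℕ) (r : R) :
    Str (Fintype.card (Fin n ⊕ {q // q ≠ r} × Fin l)) ≃ Str n × ({q // q ≠ r} → Str l) where
  toFun z := (fun w => z (spareEquiv n l r (.inl w)),
    fun q k => z (spareEquiv n l r (.inr (q, k))))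
  invFun p := fun i => Sum.elim p.1 (fun q => p.2 q.1 q.2) ((spareEquiv n l r).symm i)
  left_inv z := by
    ext i
    obtain ⟨w, rfl⟩ := (spareEquiv n l r).surjective i
    rcases w with w | ⟨q, k⟩ <;> simp
  right_inv p := by
    ext1 <;> simp

/-- The contents of the registers other than `r`: copies of the states `η`, after an exchange of
the registers `r` and `s`. -/
noncomputable def spareState (r s : R) (η : R → PureState l) (f : {q // q ≠ r} → Str l) : ℂ :=
  ∏ q : {q // q ≠ r}, (η (Equiv.swap r s q)).1 (f q)

theorem sum_norm_sq_spareState (r s : R) (η : R → PureState l) :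
    ∑ f, ‖spareState r s η f‖ ^ 2 = 1 := by
  simp only [spareState, norm_prod, ← Finset.prod_pow]
  rw [← Fintype.piFinset_univ, ← Finset.prod_univ_sum (fun _ => Finset.univ)
    (fun (q : {q // q ≠ r}) a => ‖(η (Equiv.swap r s q)).1 a‖ ^ 2)]
  exact Finset.prod_eq_one fun q _ => sum_norm_sq_pureState _

/-- The adversary for a single round that runs the adversary `E` for the rounds `R`: the challenge
is used in the round `s`, the states `η`, which are part of the advice, are used in the other
rounds, and the reply is the one in the round `r`. -/
noncomputable def Adversary.single (E : Adversary l R) (r s : R) (η : R → PureState l) :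
    Adversary l Unit where
  work := Fintype.card (Fin E.work ⊕ {q // q ≠ r} × Fin l)
  advice := fun z => E.advice (spareStrEquiv E.work l r z).1 *
    spareState r s η (spareStrEquiv E.work l r z).2
  advice_norm := by
    rw [← (spareStrEquiv E.work l r).symm.sum_comp, Fintype.sum_prod_type]
    simp only [Equiv.apply_symm_apply, norm_mul, mul_pow]
    simp only [← Finset.mul_sum, sum_norm_sq_spareState, mul_one, E.advice_norm]
  learn := E.learn.map (LearnStep.relabel (workEmbedding E.work l r))
  attack := (swapRegisterGates E.work l r s ++ E.attack).map
    (Gate.relabel (wireEquiv E.work l r).toEmbedding)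

theorem Adversary.size_single_le (E : Adversary l R) (r s : R) (η : R → PureState l) :
    (E.single r s η).size ≤ E.size + Fintype.card R * l + 3 * l := by
  have h1 := length_swapRegisterGates_le (n := E.work) (l := l) r s
  have h2 : Fintype.card {q // q ≠ r} * l ≤ Fintype.card R * l :=
    Nat.mul_le_mul_right _ (Fintype.card_subtype_le _)
  simp only [Adversary.size, Adversary.single, List.length_map, List.length_append,
    Fintype.card_sum, Fintype.card_prod, Fintype.card_fin]
  omega

variable (E : Adversary l R) (r s : R) (η : R → PureState l)
  (U : Matrix.unitaryGroup (Str l) ℂ)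

theorem Adversary.learned_single : (E.single r s η).learned U = fun z =>
    E.learned U (spareStrEquiv E.work l r z).1 *
      spareState r s η (spareStrEquiv E.work l r z).2 := by
  refine foldl_learnStep_relabel U (workEmbedding E.work l r)
    (fun z => spareState r s η (spareStrEquiv E.work l r z).2) ?_ E.learn E.advice
  intro z z' h
  refine congrArg _ ?_
  ext q k
  refine h _ ?_
  rintro ⟨w, hw⟩
  exact Sum.inl_ne_inr ((spareEquiv E.work l r).injective hw)

/-- The final state of the single-round adversary is the final state of the given adversary, for
the challenge `θ` in the round `s` and `η` in the other rounds. -/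
theorem Adversary.final_single (θ : PureState l) : (E.single r s η).final U (fun _ => θ) =
    fun x => E.final U (Function.update η s θ) fun w => x (wireEquiv E.work l r w) := by
  -- the start state is that of `E`, with the registers `r` and `s` exchanged
  have hstart : (fun x : Fin (E.single r s η).work ⊕ Unit × Fin l → Bool =>
      (E.single r s η).learned U (fun w => x (.inl w)) *
        ∏ u : Unit, θ.1 (fun k => x (.inr (u, k)))) =
      fun x => (fun y : Fin E.work ⊕ R × Fin l → Bool => startState (E.learned U)
        (Function.update η s θ) (Sum.elim (fun w => y (Sum.inl w))
          fun p => y (Sum.inr (Equiv.swap r s p.1, p.2))))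
        (fun w => x ((wireEquiv E.work l r).toEmbedding w)) * 1 := by
    ext x
    rw [E.learned_single, mul_one]
    simp only [startState, Sum.elim_inl, Sum.elim_inr, Equiv.coe_toEmbedding]
    rw [← Equiv.prod_comp (Equiv.swap r s) fun q => (Function.update η s θ q).1 fun k =>
      x (wireEquiv E.work l r (.inr (Equiv.swap r s q, k))),
      Fintype.prod_eq_mul_prod_subtype_ne _ r]
    simp only [Equiv.swap_apply_left, Equiv.swap_apply_right, Function.update_self,
      Equiv.swap_apply_self, Finset.univ_unique, Finset.prod_singleton, wireEquiv_inr_self,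
      wireEquiv_inl]
    have h : ∀ q : {q // q ≠ r}, (Function.update η s θ (Equiv.swap r s q)).1
        (fun k => x (wireEquiv E.work l r (.inr (q.1, k)))) =
        (η (Equiv.swap r s q)).1 fun k => x (.inl (spareEquiv E.work l r (.inr (q, k)))) := by
      intro q
      rw [Function.update_of_ne]
      · simp only [wireEquiv_inr_of_ne r q.2]
        rfl
      · intro h
        exact q.2 ((Equiv.swap r s).injective (h.trans (Equiv.swap_apply_left r s).symm))
    simp only [h]
    exact (mul_assoc _ _ _).trans (congrArg _ (mul_comm _ _))
  have hfold := foldl_gate_relabel (wireEquiv E.work l r).toEmbedding (fun _ => 1)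
    (fun _ _ _ => rfl) (swapRegisterGates E.work l r s ++ E.attack)
    (fun y => startState (E.learned U)
        (Function.update η s θ) (Sum.elim (fun w => y (Sum.inl w))
          fun p => y (Sum.inr (Equiv.swap r s p.1, p.2))))
  rw [Adversary.final, hstart]
  refine hfold.trans ?_
  ext x
  rw [List.foldl_append, foldl_swapRegisterGates, mul_one]
  simp only [Sum.elim_inl, Sum.elim_inr, Equiv.swap_apply_self]
  have helim : ∀ y : Fin E.work ⊕ R × Fin l → Bool,
      Sum.elim (fun w => y (Sum.inl w)) (fun p : R × Fin l => y (Sum.inr (p.1, p.2))) = y := by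
    intro y
    ext w
    cases w <;> rfl
  simp only [helim]
  rfl

/-- The single-round adversary replies with what `E` sends in the round `r`, if `E` is handed the
challenge in the round `s` only. -/
theorem Adversary.marginal_reply_single (θ : PureState l) :
    marginal ((E.single r s η).reply U fun _ => θ) () =
      marginal (E.reply U (Function.update η s θ)) r := by
  ext a b
  rw [marginal_apply, marginal_apply]
  have hsub : ∀ (c : Str l) (e : {q : Unit // q ≠ ()} → Str l),
      glue (R := Unit) () c e = fun _ => c := by
    intro c e
    ext1 u
    exact glue_self (R := Unit) () c e
  have hwires : ∀ (z : Str (E.single r s η).work) (c : Str l),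
      (fun w => (Sum.elim z fun q : Unit × Fin l => c q.2) (wireEquiv E.work l r w)) =
      Sum.elim (spareStrEquiv E.work l r z).1 fun q =>
        glue r c (spareStrEquiv E.work l r z).2 q.1 q.2 := by
    intro z c
    ext w
    rcases w with w | ⟨q, k⟩
    · rfl
    · by_cases h : q = r
      · subst h
        rw [wireEquiv_inr_self]
        simp only [Sum.elim_inr, glue_self]
        rfl
      · rw [wireEquiv_inr_of_ne _ h]
        simp only [Sum.elim_inr, glue_of_ne _ _ _ h]
        rfl
  have : Unique ({q : Unit // q ≠ ()} → Str l) :=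
    { default := fun q => absurd rfl q.2, uniq := fun f => by ext q; exact absurd rfl q.2 }
  rw [Fintype.sum_unique]
  simp only [hsub, Adversary.reply, Matrix.of_apply, E.final_single]
  rw [Finset.sum_comm, ← Fintype.sum_prod_type']
  refine Fintype.sum_equiv (spareStrEquiv E.work l r) _ _ fun z => ?_
  have h1 := hwires z a
  have h2 := hwires z b
  rw [← h1, ← h2]

end Single

/-! ### The SWAP test -/

section SwapTest

theorem swapKraus_apply {H : Type} [Fintype H] [DecidableEq H] (p q : H × H) :
    swapKraus H p q = ((if p = q then 1 else 0) + if p = q.swap then 1 else 0) / 2 := by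
  have h2 : ((Real.sqrt 2 : ℝ) : ℂ) * (Real.sqrt 2 : ℝ) = 2 := by
    rw [← Complex.ofReal_mul, Real.mul_self_sqrt (by norm_num)]
    norm_num
  have h0 : ((Real.sqrt 2 : ℝ) : ℂ) ≠ 0 := by
    intro h
    rw [h] at h2
    norm_num at h2
  simp only [swapKraus, swapCircuit, Matrix.of_apply, Matrix.mul_apply,
    Matrix.kroneckerMap_apply, Fintype.sum_prod_type (α₁ := Bool), Matrix.one_apply, mul_ite,
    mul_one, mul_zero, Finset.sum_ite_eq', Finset.mem_univ, if_true, Fintype.sum_bool,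
    Prod.mk.injEq]
  have h3 : (((Real.sqrt 2 : ℝ) : ℂ))⁻¹ * ((Real.sqrt 2 : ℝ) : ℂ)⁻¹ = 2⁻¹ := by
    rw [← mul_inv, h2]
  simp [hadamardBit]
  split_ifs <;> norm_num [h3]

/-- The effect of acceptance is `(1 + SWAP) / 2`, the projection on the symmetric subspace. -/
theorem swapEffect_apply {H : Type} [Fintype H] [DecidableEq H] (p q : H × H) :
    swapEffect H p q = ((if p = q then 1 else 0) + if p = q.swap then 1 else 0) / 2 := by
  have h : ∀ u : H × H, (u = p.swap ↔ p = u.swap) := fun u =>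
    ⟨fun h => by rw [h, Prod.swap_swap], fun h => by rw [h, Prod.swap_swap]⟩
  simp only [swapEffect, Matrix.mul_apply, Matrix.conjTranspose_apply, swapKraus_apply]
  have h1 : ∀ u : H × H,
      star (((if u = p then (1 : ℂ) else 0) + if u = p.swap then 1 else 0) / 2) *
        (((if u = q then 1 else 0) + if u = q.swap then 1 else 0) / 2) =
      (if u = p then (((if u = q then 1 else 0) + if u = q.swap then 1 else 0) / 4) else 0) +
      (if u = p.swap then
        (((if u = q then 1 else 0) + if u = q.swap then 1 else 0) / 4) else 0) := by
    intro u
    split_ifs <;> norm_num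
  simp only [h1, Finset.sum_add_distrib, Finset.sum_ite_eq', Finset.mem_univ, if_true]
  have h4 : p.swap = q ↔ p = q.swap := by rw [← h q, eq_comm]
  have h5 : p.swap = q.swap ↔ p = q := Prod.swap_inj
  simp only [h4, h5]
  ring

variable {S R : Type} [Fintype R]

/-- The tensor product, over the rounds, of operators `A r`. -/
def tensorPower (A : R → Matrix S S ℂ) : Matrix (R → S) (R → S) ℂ :=
  Matrix.of fun x y => ∏ r, A r (x r) (y r)

theorem conjTranspose_tensorPower (A : R → Matrix S S ℂ) :
    (tensorPower A)ᴴ = tensorPower fun r => (A r)ᴴ := by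
  ext x y
  simp [tensorPower, Matrix.conjTranspose_apply]

variable [DecidableEq R]

/-- The operator on the rounds that projects on the state `ψ r` in every round `r` of `T`. -/
noncomputable def projectOn [DecidableEq S] (ψ : R → S → ℂ) (T : Finset R) :
    Matrix (R → S) (R → S) ℂ :=
  tensorPower fun r => if r ∈ T then Matrix.vecMulVec (ψ r) (star (ψ r)) else 1

theorem projectOn_empty [DecidableEq S] (ψ : R → S → ℂ) : projectOn ψ ∅ = 1 := by
  ext x y
  simp only [projectOn, tensorPower, Finset.notMem_empty, if_false, Matrix.of_apply,
    Matrix.one_apply]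
  rw [Finset.prod_ite_zero]
  simp [funext_iff]

variable [Fintype S]

theorem sum_prod_apply (f : R → S → ℂ) : ∑ x : R → S, ∏ r, f r (x r) = ∏ r, ∑ a, f r a := by
  rw [Finset.prod_univ_sum, Fintype.piFinset_univ]

theorem tensorPower_mul (A B : R → Matrix S S ℂ) :
    tensorPower A * tensorPower B = tensorPower fun r => A r * B r := by
  ext x y
  simp only [tensorPower, Matrix.mul_apply, Matrix.of_apply, ← Finset.prod_mul_distrib]
  exact sum_prod_apply fun r a => A r (x r) a * B r a (y r)

theorem trace_tensorPower (A : R → Matrix S S ℂ) :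
    (tensorPower A).trace = ∏ r, (A r).trace :=
  sum_prod_apply fun r a => A r a a

open scoped MatrixOrder in
theorem exists_eq_conjTranspose_mul_self [DecidableEq S] {A : Matrix S S ℂ} (hA : A.PosSemidef) :
    ∃ B : Matrix S S ℂ, A = Bᴴ * B :=
  CStarAlgebra.nonneg_iff_eq_star_mul_self.mp hA.nonneg

theorem posSemidef_tensorPower [DecidableEq S] {A : R → Matrix S S ℂ}
    (hA : ∀ r, (A r).PosSemidef) : (tensorPower A).PosSemidef := by
  have h : ∀ r, ∃ B : Matrix S S ℂ, A r = Bᴴ * B := fun r =>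
    exists_eq_conjTranspose_mul_self (hA r)
  choose B hB using h
  have : tensorPower A = (tensorPower B)ᴴ * tensorPower B := by
    rw [conjTranspose_tensorPower, tensorPower_mul]
    congr 1
    ext1 r
    exact hB r
  rw [this]
  exact Matrix.posSemidef_conjTranspose_mul_self _

theorem re_trace_mul_nonneg [DecidableEq S] {A B : Matrix S S ℂ} (hA : A.PosSemidef)
    (hB : B.PosSemidef) : 0 ≤ (A * B).trace.re := by
  obtain ⟨C, rfl⟩ := exists_eq_conjTranspose_mul_self hA
  rw [Matrix.mul_assoc, Matrix.trace_mul_comm]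
  exact (Complex.le_def.1 (hB.mul_mul_conjTranspose_same C).trace_nonneg).1

theorem posSemidef_one_sub_vecMulVec [DecidableEq S] {u : S → ℂ} (hu : ∑ a, ‖u a‖ ^ 2 = 1) :
    (1 - Matrix.vecMulVec u (star u)).PosSemidef := by
  have huu : star u ⬝ᵥ u = 1 := by
    rw [dotProduct, ← Complex.ofReal_one, ← hu]
    push_cast
    refine Finset.sum_congr rfl fun x _ => ?_
    rw [Pi.star_apply, Complex.star_def, Complex.conj_mul']
  have h1 : Matrix.vecMulVec u (star u) * Matrix.vecMulVec u (star u) =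
      Matrix.vecMulVec u (star u) := by
    rw [Matrix.vecMulVec_mul_vecMulVec, huu, one_smul]
  have h2 : (Matrix.vecMulVec u (star u))ᴴ = Matrix.vecMulVec u (star u) := by
    rw [Matrix.conjTranspose_vecMulVec, star_star]
  have h3 : 1 - Matrix.vecMulVec u (star u) =
      (1 - Matrix.vecMulVec u (star u))ᴴ * (1 - Matrix.vecMulVec u (star u)) := by
    rw [Matrix.conjTranspose_sub, Matrix.conjTranspose_one, h2, Matrix.mul_sub, Matrix.sub_mul,
      Matrix.sub_mul, h1]
    simp
  rw [h3]
  exact Matrix.posSemidef_conjTranspose_mul_self _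

/-- One more projective test can only lower the probability to pass: the difference of the effects
is a tensor product of positive semidefinite matrices. -/
theorem re_trace_mul_projectOn_insert_le [DecidableEq S] {ψ : R → S → ℂ}
    (hψ : ∀ r, ∑ a, ‖ψ r a‖ ^ 2 = 1) {ρ : Matrix (R → S) (R → S) ℂ} (hρ : ρ.PosSemidef)
    (T : Finset R) (k : R) :
    (ρ * projectOn ψ (insert k T)).trace.re ≤ (ρ * projectOn ψ T).trace.re := by
  by_cases hk : k ∈ T
  · rw [Finset.insert_eq_of_mem hk]
  have h : projectOn ψ T - projectOn ψ (insert k T) = tensorPower fun r =>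
      if r = k then 1 - Matrix.vecMulVec (ψ r) (star (ψ r)) else
      if r ∈ T then Matrix.vecMulVec (ψ r) (star (ψ r)) else 1 := by
    ext x y
    simp only [projectOn, tensorPower, Matrix.sub_apply, Matrix.of_apply]
    rw [← Finset.mul_prod_erase _ _ (Finset.mem_univ k),
      ← Finset.mul_prod_erase Finset.univ (fun r => (if r ∈ insert k T then
        Matrix.vecMulVec (ψ r) (star (ψ r)) else 1) (x r) (y r)) (Finset.mem_univ k),
      ← Finset.mul_prod_erase Finset.univ (fun r => (if r = k then
        1 - Matrix.vecMulVec (ψ r) (star (ψ r)) else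
        if r ∈ T then Matrix.vecMulVec (ψ r) (star (ψ r)) else 1) (x r) (y r))
        (Finset.mem_univ k)]
    have e1 : ∀ r ∈ Finset.univ.erase k, (if r ∈ insert k T then
        Matrix.vecMulVec (ψ r) (star (ψ r)) else 1) (x r) (y r) =
        (if r ∈ T then Matrix.vecMulVec (ψ r) (star (ψ r)) else 1) (x r) (y r) := by
      intro r hr
      simp [Finset.mem_insert, Finset.ne_of_mem_erase hr]
    have e2 : ∀ r ∈ Finset.univ.erase k, (if r = k then
        1 - Matrix.vecMulVec (ψ r) (star (ψ r)) else
        if r ∈ T then Matrix.vecMulVec (ψ r) (star (ψ r)) else 1) (x r) (y r) =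
        (if r ∈ T then Matrix.vecMulVec (ψ r) (star (ψ r)) else 1) (x r) (y r) := by
      intro r hr
      simp [Finset.ne_of_mem_erase hr]
    rw [Finset.prod_congr rfl e1, Finset.prod_congr rfl e2]
    simp only [hk, Finset.mem_insert_self, if_true, if_false, Matrix.sub_apply]
    ring
  have h1 := re_trace_mul_nonneg hρ (B := projectOn ψ T - projectOn ψ (insert k T)) (by
    rw [h]
    refine posSemidef_tensorPower fun r => ?_
    split_ifs
    · exact posSemidef_one_sub_vecMulVec (hψ r)
    · exact Matrix.posSemidef_vecMulVec_self_star _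
    · exact Matrix.PosSemidef.one)
  rw [Matrix.mul_sub, Matrix.trace_sub, Complex.sub_re] at h1
  linarith

theorem re_trace_mul_projectOn_le [DecidableEq S] {ψ : R → S → ℂ}
    (hψ : ∀ r, ∑ a, ‖ψ r a‖ ^ 2 = 1) {ρ : Matrix (R → S) (R → S) ℂ} (hρ : ρ.PosSemidef)
    {T : Finset R} {r : R} (hr : r ∈ T) :
    (ρ * projectOn ψ T).trace.re ≤ (ρ * projectOn ψ {r}).trace.re := by
  rw [← Finset.insert_erase hr]
  induction T.erase r using Finset.induction_on with
  | empty => rfl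
  | insert k T' _ ih =>
    rw [Finset.insert_comm]
    exact (re_trace_mul_projectOn_insert_le hψ hρ _ k).trans ih

end SwapTest

section Accept

variable {l : ℕ} {R : Type} [Fintype R] [DecidableEq R]

/-- The probability to pass the projective test in the round `r` is the squared fidelity. -/
theorem trace_mul_projectOn_singleton (ρ : Matrix (R → Str l) (R → Str l) ℂ)
    (ψ : R → Str l → ℂ) (r : R) :
    (ρ * projectOn ψ {r}).trace = star (ψ r) ⬝ᵥ (marginal ρ r *ᵥ ψ r) := by
  have h : ∀ (e e' : {q // q ≠ r} → Str l) (a b : Str l),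
      projectOn ψ {r} (glue r b e') (glue r a e) =
        if e' = e then ψ r b * star (ψ r a) else 0 := by
    intro e e' a b
    simp only [projectOn, tensorPower, Matrix.of_apply, Finset.mem_singleton]
    rw [Fintype.prod_eq_mul_prod_subtype_ne _ r]
    have h1 : ∀ q : {q // q ≠ r}, (if (q : R) = r then
        Matrix.vecMulVec (ψ q) (star (ψ q)) else 1) (glue r b e' q) (glue r a e q) =
        if e' q = e q then 1 else 0 := by
      intro q
      rw [if_neg q.2, Matrix.one_apply, glue_of_ne _ _ _ q.2, glue_of_ne _ _ _ q.2]
    simp only [h1, if_true, glue_self]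
    rw [Finset.prod_ite_zero]
    simp [funext_iff, Matrix.vecMulVec_apply]
  simp only [Matrix.trace, Matrix.diag_apply, Matrix.mul_apply]
  rw [← sum_glue r]
  simp only [← sum_glue r (fun y => ρ _ y * projectOn ψ {r} y _), h]
  simp only [mul_ite, mul_zero]
  simp only [dotProduct, Matrix.mulVec, Pi.star_apply, marginal_apply, Finset.sum_mul,
    Finset.mul_sum]
  have h2 : ∀ (e : {q // q ≠ r} → Str l) (a : Str l), (∑ e', ∑ b, if e' = e then
      ρ (glue r a e) (glue r b e') * (ψ r b * star (ψ r a)) else 0) =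
      ∑ b, ρ (glue r a e) (glue r b e) * (ψ r b * star (ψ r a)) := by
    intro e a
    rw [Finset.sum_comm]
    simp
  simp only [h2]
  rw [Finset.sum_comm]
  refine Finset.sum_congr rfl fun a _ => ?_
  rw [Finset.sum_comm]
  refine Finset.sum_congr rfl fun b _ => Finset.sum_congr rfl fun e _ => ?_
  ring

/-- The SWAP test with the stored state `ψ` is the measurement of the effect `(1 + |ψ⟩⟨ψ|) / 2`. -/
theorem allSwapAccept_eq (ρ : Matrix (R → Str l) (R → Str l) ℂ) {ψ : R → Str l → ℂ}
    (hψ : ∀ r, ∑ a, ‖ψ r a‖ ^ 2 = 1) :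
    allSwapAccept ρ ψ = (ρ * tensorPower fun r =>
      ((1 / 2 : ℂ) • (1 + Matrix.vecMulVec (ψ r) (star (ψ r))))).trace.re := by
  have hψ' : ∀ r, ∑ a, ψ r a * star (ψ r a) = 1 := by
    intro r
    rw [← Complex.ofReal_one, ← hψ r]
    push_cast
    refine Finset.sum_congr rfl fun a _ => ?_
    rw [Complex.star_def, Complex.mul_conj']
  have h1 : ∀ (r : R) (x y : Str l), ∑ a, ∑ b, ψ r a * star (ψ r b) *
      swapEffect (Str l) (y, b) (x, a) =
      ((1 / 2 : ℂ) • (1 + Matrix.vecMulVec (ψ r) (star (ψ r)))) y x := by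
    intro r x y
    simp only [swapEffect_apply, Matrix.smul_apply, Matrix.add_apply, Matrix.one_apply,
      Matrix.vecMulVec_apply, Pi.star_apply, smul_eq_mul, Prod.swap_prod_mk, Prod.mk.injEq]
    have h2 : ∀ a b : Str l, ψ r a * star (ψ r b) * (((if y = x ∧ b = a then 1 else 0) +
        if y = a ∧ b = x then 1 else 0) / 2) =
        (if b = a then (if y = x then ψ r a * star (ψ r a) / 2 else 0) else 0) +
        (if b = x then (if a = y then ψ r y * star (ψ r x) / 2 else 0) else 0) := by
      intro a b
      rw [mul_div_assoc', mul_add, add_div]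
      congr 1
      · by_cases hb : b = a <;> by_cases hy : y = x <;> simp [hb, hy]
      · by_cases hb : b = x <;> by_cases hy : a = y <;> simp [hb, hy, eq_comm (a := y)]
    simp only [h2, Finset.sum_add_distrib, Finset.sum_ite_eq', Finset.mem_univ, if_true]
    split_ifs
    · rw [← Finset.sum_div, hψ']
      ring
    · simp
      ring
  rw [allSwapAccept]
  congr 1
  simp only [Matrix.trace, Matrix.diag_apply, Matrix.mul_apply, Matrix.of_apply]
  rw [← (Equiv.arrowProdEquivProdArrow R (fun _ => Str l) (fun _ => Str l)).symm.sum_comp,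
    Fintype.sum_prod_type]
  refine Finset.sum_congr rfl fun x _ => ?_
  simp only [← (Equiv.arrowProdEquivProdArrow R (fun _ => Str l) (fun _ => Str l)).symm.sum_comp
    (fun y : R → Str l × Str l => _), Fintype.sum_prod_type]
  rw [Finset.sum_comm]
  refine Finset.sum_congr rfl fun y _ => ?_
  simp only [Equiv.arrowProdEquivProdArrow_symm_apply, tensorPower, Matrix.of_apply, ← h1,
    mul_assoc, ← Finset.mul_sum, ← Finset.prod_mul_distrib]
  congr 1
  simp only [Finset.mul_sum]
  rw [← sum_prod_apply]
  refine Finset.sum_congr rfl fun a _ => ?_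
  rw [← sum_prod_apply (fun r b => ψ r (a r) *
    (star (ψ r b) * swapEffect (Str l) (y r, b) (x r, a r)))]

/-- The product of the effects `(1 + |ψ⟩⟨ψ|) / 2` is the average, over the sets `T` of rounds, of
the projective tests in the rounds of `T`. Every set `T` that is not empty contributes at most the
probability that one of its rounds passes the projective test, and the empty set contributes `1`. -/
theorem allSwapAccept_le {ρ : Matrix (R → Str l) (R → Str l) ℂ} (hρ : ρ.PosSemidef)
    (htr : ρ.trace = 1) {ψ : R → Str l → ℂ} (hψ : ∀ r, ∑ a, ‖ψ r a‖ ^ 2 = 1) :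
    allSwapAccept ρ ψ ≤ (1 / 2 : ℝ) ^ Fintype.card R +
      ∑ r, fidelity (marginal ρ r) (ψ r) ^ 2 := by
  have hexp : (tensorPower fun r => ((1 / 2 : ℂ) • (1 + Matrix.vecMulVec (ψ r) (star (ψ r))))) =
      ((1 / 2 : ℂ) ^ Fintype.card R) • ∑ T : Finset R, projectOn ψ T := by
    ext x y
    simp only [tensorPower, Matrix.of_apply, Matrix.smul_apply, smul_eq_mul,
      Finset.prod_mul_distrib, Finset.prod_const, Finset.card_univ, Matrix.sum_apply, projectOn,
      Matrix.add_apply]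
    congr 1
    simp only [add_comm ((1 : Matrix (Str l) (Str l) ℂ) _ _)]
    rw [Finset.prod_add, Finset.powerset_univ]
    refine Finset.sum_congr rfl fun T _ => ?_
    rw [← Finset.prod_mul_prod_compl T]
    congr 1
    · exact Finset.prod_congr rfl fun r hr => by rw [if_pos hr]
    · rw [Finset.compl_eq_univ_sdiff]
      exact Finset.prod_congr rfl fun r hr => by rw [if_neg (Finset.mem_sdiff.1 hr).2]
  set F : R → ℝ := fun r => fidelity (marginal ρ r) (ψ r) ^ 2 with hF
  have hF0 : ∀ r, 0 ≤ F r := fun r => sq_nonneg _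
  have hsing : ∀ r, (ρ * projectOn ψ {r}).trace.re = F r := by
    intro r
    rw [trace_mul_projectOn_singleton, hF, ← fidelity_sq (posSemidef_marginal hρ r)]
  have hT : ∀ T : Finset R, (ρ * projectOn ψ T).trace.re ≤
      (if T = ∅ then 1 else 0) + ∑ r, F r := by
    intro T
    rcases T.eq_empty_or_nonempty with rfl | ⟨r, hr⟩
    · rw [projectOn_empty, Matrix.mul_one, htr, if_pos rfl, Complex.one_re]
      linarith [Finset.sum_nonneg fun r (_ : r ∈ Finset.univ) => hF0 r]
    · rw [if_neg (Finset.ne_empty_of_mem hr), zero_add]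
      refine (re_trace_mul_projectOn_le hψ hρ hr).trans ?_
      rw [hsing]
      exact Finset.single_le_sum (fun r _ => hF0 r) (Finset.mem_univ r)
  rw [allSwapAccept_eq ρ hψ, hexp, Matrix.mul_smul, Matrix.trace_smul, smul_eq_mul,
    Matrix.mul_sum, Matrix.trace_sum]
  have hre : ((1 / 2 : ℂ) ^ Fintype.card R * ∑ T : Finset R, (ρ * projectOn ψ T).trace).re =
      (1 / 2 : ℝ) ^ Fintype.card R * ∑ T : Finset R, (ρ * projectOn ψ T).trace.re := by
    rw [show (1 / 2 : ℂ) ^ Fintype.card R = (((1 / 2 : ℝ) ^ Fintype.card R : ℝ) : ℂ) by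
      push_cast; rfl, Complex.re_ofReal_mul, Complex.re_sum]
  rw [hre]
  calc (1 / 2 : ℝ) ^ Fintype.card R * ∑ T : Finset R, (ρ * projectOn ψ T).trace.re
      ≤ (1 / 2 : ℝ) ^ Fintype.card R *
        ∑ T : Finset R, ((if T = ∅ then 1 else 0) + ∑ r, F r) := by
        gcongr with T
        exact hT T
    _ = (1 / 2 : ℝ) ^ Fintype.card R + ((1 / 2 : ℝ) ^ Fintype.card R * 2 ^ Fintype.card R) *
          ∑ r, F r := by
        rw [Finset.sum_add_distrib, Finset.sum_ite_eq', if_pos (Finset.mem_univ _),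
          Finset.sum_const, Finset.card_univ, Fintype.card_finset, nsmul_eq_mul]
        push_cast
        ring
    _ = _ := by rw [← mul_pow]; norm_num

theorem allSwapAccept_nonneg {ρ : Matrix (R → Str l) (R → Str l) ℂ} (hρ : ρ.PosSemidef)
    {ψ : R → Str l → ℂ} (hψ : ∀ r, ∑ a, ‖ψ r a‖ ^ 2 = 1) : 0 ≤ allSwapAccept ρ ψ := by
  rw [allSwapAccept_eq ρ hψ]
  refine re_trace_mul_nonneg hρ (posSemidef_tensorPower fun r => ?_)
  refine Matrix.PosSemidef.smul ?_ (by norm_num [Complex.le_def])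
  exact Matrix.PosSemidef.one.add (Matrix.posSemidef_vecMulVec_self_star _)

theorem allSwapAccept_of_unentangled {ρ : Matrix (R → Str l) (R → Str l) ℂ} (h : Unentangled ρ)
    {ψ : R → Str l → ℂ} (hψ : ∀ r, ∑ a, ‖ψ r a‖ ^ 2 = 1) :
    allSwapAccept ρ ψ = ∏ r, (1 / 2 + fidelity (marginal ρ r) (ψ r) ^ 2 / 2) := by
  obtain ⟨σ, hσ, rfl⟩ := h
  have hmar : ∀ r, marginal (Matrix.of fun x y => ∏ r, σ r (x r) (y r)) r = σ r := by
    intro r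
    ext a b
    rw [marginal_apply]
    simp only [Matrix.of_apply, Fintype.prod_eq_mul_prod_subtype_ne _ r, glue_self]
    have h1 : ∀ e : {q // q ≠ r} → Str l, ∏ q : {q // q ≠ r},
        σ q (glue r a e q) (glue r b e q) = ∏ q : {q // q ≠ r}, σ q (e q) (e q) :=
      fun e => Finset.prod_congr rfl fun q _ => by
        rw [glue_of_ne _ _ _ q.2, glue_of_ne _ _ _ q.2]
    simp only [h1]
    rw [← Finset.mul_sum, sum_prod_apply fun (q : {q // q ≠ r}) c => σ q c c]
    have h2 : ∏ q : {q // q ≠ r}, ∑ c, σ q c c = 1 :=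
      Finset.prod_eq_one fun q _ => (hσ q).2
    rw [h2, mul_one]
  rw [allSwapAccept_eq _ hψ]
  change ((tensorPower σ) * _).trace.re = _
  rw [tensorPower_mul, trace_tensorPower]
  have hfac : ∀ r, (σ r * ((1 / 2 : ℂ) • (1 + Matrix.vecMulVec (ψ r) (star (ψ r))))).trace =
      ((1 / 2 + fidelity (σ r) (ψ r) ^ 2 / 2 : ℝ) : ℂ) := by
    intro r
    have h2 : star (ψ r) ⬝ᵥ (σ r *ᵥ ψ r) = ((fidelity (σ r) (ψ r) ^ 2 : ℝ) : ℂ) := by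
      rw [fidelity_sq (hσ r).1]
      apply Complex.ext
      · rfl
      · rw [Complex.ofReal_im]
        exact (Complex.le_def.1 ((hσ r).1.dotProduct_mulVec_nonneg (ψ r))).2.symm
    rw [Matrix.mul_smul, Matrix.trace_smul, Matrix.mul_add, Matrix.trace_add, Matrix.mul_one,
      (hσ r).2, Matrix.mul_vecMulVec, Matrix.trace_vecMulVec, dotProduct_comm, h2, smul_eq_mul]
    push_cast
    ring
  simp only [hfac, hmar]
  rw [← Complex.ofReal_prod, Complex.ofReal_re]

end Accept

/-! ### From many copies of a challenge to a single copy -/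

section Copies

variable {l N M : ℕ}

/-- Contents of the challenge registers: the states `v j` in the rounds `(i, j)`, and the challenges
`φ k` in the rounds `(k, j)` with `k ≠ i`. -/
def mixedChallenges (φ : Fin N → PureState l) (i : Fin N) (v : Fin M → PureState l) :
    Fin N × Fin M → PureState l :=
  fun p => if p.1 = i then v p.2 else φ p.1

theorem mixedChallenges_const (φ : Fin N → PureState l) (i : Fin N) (θ : PureState l) :
    mixedChallenges (M := M) φ i (fun _ => θ) = fun p => Function.update φ i θ p.1 := by
  ext1 p
  by_cases h : p.1 = i
  · simp [mixedChallenges, h]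
  · simp [mixedChallenges, h]

theorem mixedChallenges_update (φ : Fin N → PureState l) (i : Fin N) (v : Fin M → PureState l)
    (j : Fin M) (θ : PureState l) :
    mixedChallenges φ i (Function.update v j θ) =
      Function.update (mixedChallenges φ i v) (i, j) θ := by
  ext1 p
  obtain ⟨k, j'⟩ := p
  by_cases h : k = i
  · subst h
    by_cases hj : j' = j
    · subst hj
      simp [mixedChallenges]
    · rw [Function.update_of_ne (by simp [hj])]
      simp [mixedChallenges, hj]
  · rw [Function.update_of_ne (by simp [h])]
    simp [mixedChallenges, h]

/-- The mean squared fidelity with `M` copies of the challenge `θ` is controlled by those with a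
single copy of `θ`, in a round `(r.1, j)`, and copies of an independent state `χ` in the other
rounds `(r.1, k)`. -/
theorem integral_fidelity_copies_le (E : Adversary l (Fin N × Fin M))
    (U : Matrix.unitaryGroup (Str l) ℂ) (φ : Fin N → PureState l) (r : Fin N × Fin M) :
    ∫ θ, fidelity (marginal (E.reply U (mixedChallenges φ r.1 fun _ => θ)) r)
        (response U θ) ^ 2 ∂haarState l ≤ (1 / 2 : ℝ) ^ l +
      M * ∑ j, ∫ χ, ∫ θ, fidelity (marginal (E.reply U (Function.update
        (mixedChallenges φ r.1 fun _ => χ) (r.1, j) θ)) r) (response U θ) ^ 2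
          ∂haarState l ∂haarState l := by
  obtain ⟨i, j1⟩ := r
  obtain ⟨m, rfl⟩ : ∃ m, M = m + 1 := ⟨M - 1, by have := j1.2; omega⟩
  obtain ⟨G, hG, hfin⟩ := E.exists_attack_isometry
  let Ω := Fin E.work ⊕ (Fin N × Fin (m + 1)) × Fin l → Bool
  let K := Str E.work × ({q : Fin N × Fin (m + 1) // q ≠ (i, j1)} → Str l)
  let out : K → Str l → Ω := fun k b => Sum.elim k.1 fun p => glue (i, j1) b k.2 p.1 p.2
  let C : Ω → ℂ := fun w => E.learned U (fun t => w (.inl t)) *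
    ∏ k ∈ Finset.univ.erase i, ∏ j : Fin (m + 1), (φ k).1 fun t => w (.inr ((k, j), t))
  let x : Ω → Fin (m + 1) → Str l := fun w j t => w (.inr ((i, j), t))
  let a : K → Str l → Ω → ℂ := fun k y w => ∑ b, star (U.1 b y) * (G (out k b) w * C w)
  have hstart : ∀ (v : Fin (m + 1) → PureState l) (w : Ω),
      startState (E.learned U) (mixedChallenges φ i v) w = C w * ∏ j, (v j).1 (x w j) := by
    intro v w
    simp only [startState, Fintype.prod_prod_type, C]
    rw [← Finset.mul_prod_erase _ _ (Finset.mem_univ i), mul_assoc]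
    congr 1
    rw [mul_comm]
    congr 1
    · refine Finset.prod_congr rfl fun k hk => ?_
      simp only [mixedChallenges, if_neg (Finset.ne_of_mem_erase hk)]
    · simp only [mixedChallenges, if_true, x]
  -- for the outcome `k` outside the round `(i, j1)`, the reply, pulled back by the device, is a
  -- polynomial in the contents `v` of the rounds with the number `i`
  have hT : ∀ (v : Fin (m + 1) → PureState l) (k : K) (y : Str l),
      ∑ w, a k y w * ∏ j, (v j).1 (x w j) =
        (U.1ᴴ *ᵥ fun b => E.final U (mixedChallenges φ i v) (out k b)) y := by
    intro v k y
    simp only [hfin, Matrix.mulVec, dotProduct, hstart, Matrix.conjTranspose_apply, a,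
      Finset.sum_mul, Finset.mul_sum]
    rw [Finset.sum_comm]
    refine Finset.sum_congr rfl fun b _ => Finset.sum_congr rfl fun w _ => ?_
    ring
  have hfid : ∀ (v : Fin (m + 1) → PureState l) (θ : PureState l),
      fidelity (marginal (E.reply U (mixedChallenges φ i v)) (i, j1)) (response U θ) ^ 2 =
        ∑ k : K, ‖∑ y, star (θ.1 y) * ∑ w, a k y w * ∏ j, (v j).1 (x w j)‖ ^ 2 := by
    intro v θ
    rw [E.fidelity_marginal_reply_sq, Fintype.sum_prod_type]
    refine Finset.sum_congr rfl fun z _ => Finset.sum_congr rfl fun e _ => ?_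
    congr 2
    simp only [hT, response, Matrix.mulVec, dotProduct, Matrix.conjTranspose_apply, star_sum,
      Finset.sum_mul, Finset.mul_sum]
    rw [Finset.sum_comm]
    refine Finset.sum_congr rfl fun b _ => Finset.sum_congr rfl fun y _ => ?_
    rw [star_mul']
    ring
  have hone : ∀ v : Fin (m + 1) → PureState l,
      ∑ k : K, ∑ y, ‖∑ w, a k y w * ∏ j, (v j).1 (x w j)‖ ^ 2 = 1 := by
    intro v
    have hU : (U.1ᴴ)ᴴ * U.1ᴴ = 1 := by
      rw [Matrix.conjTranspose_conjTranspose]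
      exact Matrix.mem_unitaryGroup_iff.1 U.2
    simp only [hT]
    rw [← E.sum_norm_sq_final U (mixedChallenges φ i v), ← sum_wires, Fintype.sum_prod_type]
    refine Finset.sum_congr rfl fun z _ => ?_
    rw [← sum_glue (i, j1)]
    exact Finset.sum_congr rfl fun e _ => sum_norm_sq_mulVec hU _
  have hc : ∀ (k : K) (v : PureState l → Fin (m + 1) → PureState l),
      (∀ j, Continuous fun θ => v θ j) → Integrable (fun θ : PureState l =>
        ‖∑ y, star (θ.1 y) * ∑ w, a k y w * ∏ j, (v θ j).1 (x w j)‖ ^ 2) (haarState l) := by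
    intro k v hv
    have hv' : ∀ j s, Continuous fun θ => (v θ j).1 s := fun j s =>
      (continuous_coord s).comp (hv j)
    exact integrable_haarState (by fun_prop)
  have hupd : ∀ (χ : PureState l) (j j' : Fin (m + 1)),
      Continuous fun θ : PureState l => Function.update (fun _ => χ) j θ j' := by
    intro χ j j'
    by_cases h : j' = j
    · subst h
      simpa using continuous_id'
    · simpa [Function.update_of_ne h] using continuous_const
  simp only [← mixedChallenges_update, hfid]
  rw [integral_finsetSum _ fun k _ => hc k (fun θ _ => θ) fun _ => continuous_id]
  have hsum : ∀ j : Fin (m + 1), (∫ χ, ∫ θ, ∑ k : K, ‖∑ y, star (θ.1 y) * ∑ w, a k y w *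
      ∏ j', (Function.update (fun _ => χ) j θ j').1 (x w j')‖ ^ 2 ∂haarState l ∂haarState l) =
      ∑ k : K, ∫ χ, ∫ θ, ‖∑ y, star (θ.1 y) * ∑ w, a k y w *
        ∏ j', (Function.update (fun _ => χ) j θ j').1 (x w j')‖ ^ 2 ∂haarState l ∂haarState l := by
    intro j
    rw [← integral_finsetSum _ fun k _ => integrable_integral_copies (a k) x j]
    congr 1
    ext χ
    exact integral_finsetSum _ fun k _ => hc k _ (hupd χ j)
  simp only [hsum]
  refine (Finset.sum_le_sum fun k _ => integral_haarState_copies_le (a k) x (m := m)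
    (by simp)).trans ?_
  rw [Finset.sum_add_distrib, ← Finset.mul_sum, ← Finset.mul_sum, Finset.sum_comm,
    ← integral_finsetSum _ fun k _ => integrable_haarState (by fun_prop)]
  simp only [hone fun _ => _]
  simp

end Copies

/-! ### Averages over the device and the challenges -/

section UnitBounded

variable {X Y : Type*} [MeasurableSpace X] [MeasurableSpace Y]

/-- Measurable with values in the unit interval. -/
def IsUnitBounded (f : X → ℝ) : Prop := Measurable f ∧ ∀ x, 0 ≤ f x ∧ f x ≤ 1

theorem IsUnitBounded.integrable {f : X → ℝ} (hf : IsUnitBounded f) (μ : Measure X)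
    [IsFiniteMeasure μ] : Integrable f μ :=
  Integrable.of_bound hf.1.aestronglyMeasurable 1 (Filter.Eventually.of_forall fun x => by
    rw [Real.norm_of_nonneg (hf.2 x).1]
    exact (hf.2 x).2)

theorem IsUnitBounded.integral_mem {f : X → ℝ} (hf : IsUnitBounded f) (μ : Measure X)
    [IsProbabilityMeasure μ] : 0 ≤ ∫ x, f x ∂μ ∧ ∫ x, f x ∂μ ≤ 1 := by
  refine ⟨integral_nonneg fun x => (hf.2 x).1, ?_⟩
  calc ∫ x, f x ∂μ ≤ ∫ _, (1 : ℝ) ∂μ :=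
        integral_mono (hf.integrable μ) (integrable_const _) fun x => (hf.2 x).2
    _ = 1 := by simp

theorem IsUnitBounded.comp {f : Y → ℝ} (hf : IsUnitBounded f) {g : X → Y} (hg : Measurable g) :
    IsUnitBounded fun x => f (g x) :=
  ⟨hf.1.comp hg, fun x => hf.2 (g x)⟩

theorem IsUnitBounded.integral {f : X → Y → ℝ} (hf : IsUnitBounded fun p : X × Y => f p.1 p.2)
    (ν : Measure Y) [IsProbabilityMeasure ν] : IsUnitBounded fun x => ∫ y, f x y ∂ν :=
  ⟨(hf.1.stronglyMeasurable.integral_prod_right (ν := ν)).measurable,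
    fun x => (hf.comp (measurable_const.prodMk measurable_id : Measurable fun y : Y => (x, y))
      ).integral_mem ν⟩

/-- Drawing one coordinate anew does not change a product of equal laws. -/
theorem measurePreserving_update {N : ℕ} (μ : Measure X) [IsProbabilityMeasure μ] (i : Fin N) :
    MeasurePreserving (fun p : (Fin N → X) × X => Function.update p.1 i p.2)
      ((Measure.pi fun _ => μ).prod μ) (Measure.pi fun _ => μ) := by
  have hm : Measurable fun p : (Fin N → X) × X => Function.update p.1 i p.2 := by
    refine measurable_pi_lambda _ fun k => ?_
    by_cases h : k = i
    · subst h
      simpa using measurable_snd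
    · simp only [Function.update_of_ne h]
      exact (measurable_pi_apply k).comp measurable_fst
  refine ⟨hm, (Measure.pi_eq fun s hs => ?_).symm⟩
  have hpre : (fun p : (Fin N → X) × X => Function.update p.1 i p.2) ⁻¹' Set.univ.pi s =
      (Set.univ.pi (Function.update s i Set.univ)) ×ˢ s i := by
    ext p
    simp only [Set.mem_preimage, Set.mem_univ_pi, Set.mem_prod]
    constructor
    · intro h
      refine ⟨fun k => ?_, by simpa using h i⟩
      by_cases hk : k = i
      · subst hk
        simp
      · simpa [Function.update_of_ne hk] using h k
    · rintro ⟨h1, h2⟩ k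
      by_cases hk : k = i
      · subst hk
        simpa using h2
      · simpa [Function.update_of_ne hk] using h1 k
  rw [Measure.map_apply hm (MeasurableSet.univ_pi hs), hpre, Measure.prod_prod, Measure.pi_pi,
    ← Finset.mul_prod_erase _ _ (Finset.mem_univ i),
    ← Finset.mul_prod_erase _ (fun k => μ (s k)) (Finset.mem_univ i), Function.update_self,
    measure_univ, one_mul, mul_comm]
  congr 1
  exact Finset.prod_congr rfl fun k hk => by rw [Function.update_of_ne (Finset.ne_of_mem_erase hk)]

/-- If the mean of `f` over the coordinate `i` is bounded, for fixed values of everything else, by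
means of functions `q j` that involve another, independent element `χ`, then the mean of `f` is
bounded in terms of the means of `q j` for fixed `φ` and `χ`. -/
theorem integral_resample_le {A : Type*} [MeasurableSpace A] {N M : ℕ} (μ : Measure A)
    [IsProbabilityMeasure μ] (ν : Measure X) [IsProbabilityMeasure ν] {f : A × (Fin N → X) → ℝ}
    (hf : IsUnitBounded f) {q : Fin M → A → (Fin N → X) → X → X → ℝ}
    (hq : ∀ j, IsUnitBounded fun p : ((A × (Fin N → X)) × X) × X =>
      q j p.1.1.1 p.1.1.2 p.1.2 p.2) (i : Fin N) {c B : ℝ}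
    (hle : ∀ U φ, ∫ θ, f (U, Function.update φ i θ) ∂ν ≤
      c + M * ∑ j, ∫ χ, ∫ θ, q j U φ χ θ ∂ν ∂ν)
    (hB : ∀ j φ χ, ∫ U, ∫ θ, q j U φ χ θ ∂ν ∂μ ≤ B) :
    ∫ p, f p ∂μ.prod (Measure.pi fun _ => ν) ≤ c + M * (M * B) := by
  set Φ := Measure.pi fun _ : Fin N => ν with hΦ
  have hq1 : ∀ j, IsUnitBounded fun p : (A × (Fin N → X)) × X =>
      ∫ θ, q j p.1.1 p.1.2 p.2 θ ∂ν := fun j =>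
    IsUnitBounded.integral (f := fun (p : (A × (Fin N → X)) × X) θ =>
      q j p.1.1 p.1.2 p.2 θ) (hq j) ν
  have hq2 : ∀ j, IsUnitBounded fun p : A × (Fin N → X) =>
      ∫ χ, ∫ θ, q j p.1 p.2 χ θ ∂ν ∂ν := fun j =>
    IsUnitBounded.integral (f := fun (p : A × (Fin N → X)) χ => ∫ θ, q j p.1 p.2 χ θ ∂ν) (hq1 j) ν
  have hT : MeasurePreserving (fun p : (A × (Fin N → X)) × X =>
      (p.1.1, Function.update p.1.2 i p.2)) ((μ.prod Φ).prod ν) (μ.prod Φ) :=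
    ((MeasurePreserving.id μ).prod (measurePreserving_update ν i)).comp
      (measurePreserving_prodAssoc μ Φ ν)
  have hfT := hf.comp hT.measurable
  have h1 : ∫ p, f p ∂μ.prod Φ =
      ∫ p, ∫ θ, f (p.1, Function.update p.2 i θ) ∂ν ∂μ.prod Φ := by
    rw [← integral_prod (fun p : (A × (Fin N → X)) × X =>
      f (p.1.1, Function.update p.1.2 i p.2)) (hfT.integrable _)]
    conv_lhs => rw [← hT.map_eq]
    rw [integral_map hT.measurable.aemeasurable hf.1.aestronglyMeasurable]
  -- the integrals over `φ` and `χ` become the outer ones, so that `hB` applies inside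
  have h2 : ∀ j, ∫ p, ∫ χ, ∫ θ, q j p.1 p.2 χ θ ∂ν ∂ν ∂μ.prod Φ ≤ B := by
    intro j
    have b3 : ∀ φ, IsUnitBounded fun p : A × X => ∫ θ, q j p.1 φ p.2 θ ∂ν := fun φ =>
      (hq1 j).comp (g := fun p : A × X => ((p.1, φ), p.2)) (by fun_prop)
    have b4 : IsUnitBounded fun p : ((Fin N → X) × X) × A => ∫ θ, q j p.2 p.1.1 p.1.2 θ ∂ν :=
      (hq1 j).comp (g := fun p : ((Fin N → X) × X) × A => ((p.2, p.1.1), p.1.2)) (by fun_prop)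
    have b5 := IsUnitBounded.integral
      (f := fun (p : (Fin N → X) × X) U => ∫ θ, q j U p.1 p.2 θ ∂ν) b4 μ
    have b6 := IsUnitBounded.integral (f := fun φ χ => ∫ U, ∫ θ, q j U φ χ θ ∂ν ∂μ) b5 ν
    rw [integral_prod_symm _ ((hq2 j).integrable _)]
    have h3 : ∀ φ, ∫ U, ∫ χ, ∫ θ, q j U φ χ θ ∂ν ∂ν ∂μ = ∫ χ, ∫ U, ∫ θ, q j U φ χ θ ∂ν ∂μ ∂ν :=
      fun φ => integral_integral_swap ((b3 φ).integrable _)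
    simp only [h3]
    have h5 : ∀ φ, ∫ χ, ∫ U, ∫ θ, q j U φ χ θ ∂ν ∂μ ∂ν ≤ B := fun φ => by
      calc _ ≤ ∫ _, B ∂ν :=
            integral_mono ((b5.comp (g := fun χ : X => (φ, χ)) (by fun_prop)).integrable _)
              (integrable_const _) fun χ => hB j φ χ
        _ = B := by simp
    calc _ ≤ ∫ _, B ∂Φ := integral_mono (b6.integrable _) (integrable_const _) fun φ => h5 φ
      _ = B := by simp
  have hsum : Integrable (fun p : A × (Fin N → X) =>
      M * ∑ j, ∫ χ, ∫ θ, q j p.1 p.2 χ θ ∂ν ∂ν) (μ.prod Φ) :=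
    (integrable_finsetSum _ fun j _ => (hq2 j).integrable _).const_mul _
  rw [h1]
  calc _ ≤ ∫ p, (c + M * ∑ j, ∫ χ, ∫ θ, q j p.1 p.2 χ θ ∂ν ∂ν) ∂μ.prod Φ :=
        integral_mono ((IsUnitBounded.integral
          (f := fun (p : A × (Fin N → X)) θ => f (p.1, Function.update p.2 i θ)) hfT
            ν).integrable _)
          ((integrable_const _).add hsum) fun p => hle p.1 p.2
    _ = c + M * ∑ j, ∫ p, ∫ χ, ∫ θ, q j p.1 p.2 χ θ ∂ν ∂ν ∂μ.prod Φ := by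
        rw [integral_add (integrable_const _) hsum, integral_const_mul,
          integral_finsetSum _ fun j _ => (hq2 j).integrable _]
        simp
    _ ≤ c + M * ∑ _j : Fin M, B := by
        gcongr with j
        exact h2 j
    _ = _ := by simp

end UnitBounded

section Average

instance (P : UnitaryQPUF) (l : ℕ) : IsProbabilityMeasure (P.law l) := P.isProb l

instance (P : UnitaryQPUF) (l N : ℕ) : IsProbabilityMeasure (P.gameLaw l N) := by
  unfold UnitaryQPUF.gameLaw
  infer_instance

variable {l : ℕ} {R X : Type} [Fintype R] [DecidableEq R] [MeasurableSpace X]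

theorem Adversary.isUnitBounded_fidelity_sq (E : Adversary l R)
    {U : X → Matrix.unitaryGroup (Str l) ℂ} (hU : Measurable U)
    {φ : X → R → PureState l} (hφ : ∀ r, Measurable fun ω => φ ω r)
    {θ : X → PureState l} (hθ : Measurable θ) (r : R) :
    IsUnitBounded fun ω =>
      fidelity (marginal (E.reply (U ω) (φ ω)) r) (response (U ω) (θ ω)) ^ 2 :=
  ⟨(E.measurable_fidelity hU hφ (measurable_response hU hθ) r).pow_const 2, fun _ =>
    ⟨sq_nonneg _, E.fidelity_marginal_reply_sq_le_one _ _ _ (sum_norm_sq_response _ _)⟩⟩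

/-- Mean squared fidelity of the reply of an adversary to one Haar random challenge. -/
noncomputable def UnitaryQPUF.forgeMean (P : UnitaryQPUF) (A : Adversary l Unit) : ℝ :=
  ∫ p, fidelity (marginal (A.reply p.1 fun _ => p.2) ()) (response p.1 p.2) ^ 2
    ∂(P.law l).prod (haarState l)

theorem isUnitBounded_forge (A : Adversary l Unit) :
    IsUnitBounded fun p : Matrix.unitaryGroup (Str l) ℂ × PureState l =>
      fidelity (marginal (A.reply p.1 fun _ => p.2) ()) (response p.1 p.2) ^ 2 :=
  A.isUnitBounded_fidelity_sq measurable_fst (fun _ => measurable_snd) measurable_snd ()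

theorem UnitaryQPUF.forgeMean_nonneg (P : UnitaryQPUF) (A : Adversary l Unit) :
    0 ≤ P.forgeMean A :=
  ((isUnitBounded_forge A).integral_mem _).1

theorem UnitaryQPUF.forgeMean_le_one (P : UnitaryQPUF) (A : Adversary l Unit) :
    P.forgeMean A ≤ 1 :=
  ((isUnitBounded_forge A).integral_mem _).2

/-- The fidelity is at most `1` where it is at least `δ`, and less than `δ` elsewhere. -/
theorem UnitaryQPUF.forgeMean_le (P : UnitaryQPUF) (A : Adversary l Unit) {δ : ℝ} :
    P.forgeMean A ≤ δ ^ 2 + P.forgeProb A δ := by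
  set f : Matrix.unitaryGroup (Str l) ℂ × PureState l → ℝ := fun p =>
    fidelity (marginal (A.reply p.1 fun _ => p.2) ()) (response p.1 p.2) with hf
  have hfm : Measurable f := A.measurable_fidelity measurable_fst (fun _ => measurable_snd)
    (measurable_response measurable_fst measurable_snd) ()
  have hs : MeasurableSet {p | δ ≤ f p} := measurableSet_le measurable_const hfm
  have hb := isUnitBounded_forge A
  calc P.forgeMean A
      ≤ ∫ p, (δ ^ 2 + {p | δ ≤ f p}.indicator (fun _ => (1 : ℝ)) p)
          ∂(P.law l).prod (haarState l) := by
        refine integral_mono (hb.integrable _)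
          ((integrable_const _).add ((integrable_const _).indicator hs)) fun p => ?_
        simp only [Set.indicator, Set.mem_ofPred_eq]
        split_ifs with h
        · linarith [(hb.2 p).2, sq_nonneg δ]
        · rw [add_zero]
          exact pow_le_pow_left₀ (fidelity_nonneg _ _) (le_of_lt (not_le.1 h)) 2
    _ = δ ^ 2 + P.forgeProb A δ := by
        rw [integral_add (integrable_const _) ((integrable_const _).indicator hs),
          integral_indicator_const _ hs]
        simp [UnitaryQPUF.forgeProb, hf]

theorem UnitaryQPUF.forgeMean_single (P : UnitaryQPUF) (E : Adversary l R) (r s : R)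
    (η : R → PureState l) :
    P.forgeMean (E.single r s η) = ∫ U, ∫ θ,
      fidelity (marginal (E.reply U (Function.update η s θ)) r) (response U θ) ^ 2
        ∂haarState l ∂P.law l := by
  rw [UnitaryQPUF.forgeMean, integral_prod _ ((isUnitBounded_forge _).integrable _)]
  simp only [E.marginal_reply_single]

end Average

section Game

variable {l N M : ℕ}

/-- The mean squared fidelity in a round of the protocol is bounded by the mean squared fidelities
of single-round adversaries that use the same circuits. -/
theorem UnitaryQPUF.integral_fidelity_sq_le (P : UnitaryQPUF)
    (E : Adversary l (Fin N × Fin M)) (r : Fin N × Fin M) {B : ℝ}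
    (hB : ∀ s η, P.forgeMean (E.single r s η) ≤ B) :
    ∫ p, fidelity (marginal (eveReply E p.1 p.2) r) (response p.1 (p.2 r.1)) ^ 2
      ∂P.gameLaw l N ≤ (1 / 2 : ℝ) ^ l + M * (M * B) := by
  refine integral_resample_le (P.law l) (haarState l)
    (E.isUnitBounded_fidelity_sq measurable_fst
      (fun q => (measurable_pi_apply q.1).comp measurable_snd)
      ((measurable_pi_apply r.1).comp measurable_snd) r)
    (q := fun j U φ χ θ => fidelity (marginal (E.reply U (Function.update
      (mixedChallenges φ r.1 fun _ => χ) (r.1, j) θ)) r) (response U θ) ^ 2) (fun j => ?_) r.1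
    (fun U φ => ?_) fun j φ χ => ?_
  · refine E.isUnitBounded_fidelity_sq
      (measurable_fst.comp (measurable_fst.comp measurable_fst)) (fun s => ?_) measurable_snd r
    by_cases hs : s = (r.1, j)
    · subst hs
      simpa using measurable_snd
    · simp only [Function.update_of_ne hs, mixedChallenges]
      split_ifs
      · exact measurable_snd.comp measurable_fst
      · exact (measurable_pi_apply s.1).comp
          (measurable_snd.comp (measurable_fst.comp measurable_fst))
  · refine le_of_eq_of_le ?_ (integral_fidelity_copies_le E U φ r)
    simp only [mixedChallenges_const, Function.comp_apply, Function.update_self]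
  · rw [← P.forgeMean_single E r (r.1, j)]
    exact hB _ _

end Game

/-! ### Bounds for given device and challenges -/

/-- Only the product of the terms `1 / 2` survives if all the `t i` are small. -/
theorem prod_half_add_half_le {ι : Type*} (s : Finset ι) {t : ι → ℝ}
    (ht : ∀ i, 0 ≤ t i ∧ t i ≤ 1) {T : ℝ} (hT : ∀ i, t i ≤ T) (hT0 : 0 ≤ T) :
    ∏ i ∈ s, (1 / 2 + t i / 2) ≤ (1 / 2 : ℝ) ^ s.card + T := by
  classical
  induction s using Finset.induction_on with
  | empty => simpa using hT0
  | insert a s ha ih =>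
    rw [Finset.prod_insert ha, Finset.card_insert_of_notMem ha, pow_succ]
    have h1 : ∏ i ∈ s, (1 / 2 + t i / 2) ≤ 1 :=
      Finset.prod_le_one (fun i _ => by linarith [(ht i).1]) fun i _ => by linarith [(ht i).2]
    have h2 : t a / 2 * ∏ i ∈ s, (1 / 2 + t i / 2) ≤ t a / 2 * 1 :=
      mul_le_mul_of_nonneg_left h1 (by linarith [(ht a).1])
    linarith [hT a]

section Bounds

variable {l N M : ℕ} (E : Adversary l (Fin N × Fin M)) (U : Matrix.unitaryGroup (Str l) ℂ)
  (φ : Fin N → PureState l)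

/-- The squared fidelity `F(ρ_{i,j}, U φ_i) ^ 2` in a round of the protocol. -/
noncomputable def roundFidelitySq (r : Fin N × Fin M) : ℝ :=
  fidelity (marginal (eveReply E U φ) r) (response U (φ r.1)) ^ 2

theorem roundFidelitySq_nonneg (r : Fin N × Fin M) : 0 ≤ roundFidelitySq E U φ r := sq_nonneg _

theorem sum_roundFidelitySq_nonneg : 0 ≤ ∑ r, roundFidelitySq E U φ r :=
  Finset.sum_nonneg fun _ _ => roundFidelitySq_nonneg E U φ _

theorem accept_nonneg : 0 ≤ accept E U φ :=
  allSwapAccept_nonneg (E.posSemidef_reply U _) fun _ => sum_norm_sq_response _ _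

theorem accept_le : accept E U φ ≤ (1 / 2) ^ (N * M) + ∑ r, roundFidelitySq E U φ r := by
  have h := allSwapAccept_le (E.posSemidef_reply U fun r => φ r.1) (E.trace_reply U fun r => φ r.1)
    (ψ := fun r => response U (φ r.1)) fun _ => sum_norm_sq_response _ _
  rwa [Fintype.card_prod, Fintype.card_fin, Fintype.card_fin] at h

theorem productBound_eq_prod :
    productBound E U φ = ∏ r : Fin N × Fin M, (1 / 2 + maxFidelity E U φ r.1 ^ 2 / 2) := by
  simp [productBound, Fintype.prod_prod_type]

theorem roundFidelitySq_le_maxFidelity_sq (r : Fin N × Fin M) :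
    roundFidelitySq E U φ r ≤ maxFidelity E U φ r.1 ^ 2 :=
  pow_le_pow_left₀ (fidelity_nonneg _ _) (le_ciSup (f := fun j => fidelity
    (marginal (eveReply E U φ) (r.1, j)) (response U (φ r.1)))
    (Set.finite_range _).bddAbove r.2) 2

theorem exists_maxFidelity_sq_eq (r : Fin N × Fin M) :
    ∃ j, maxFidelity E U φ r.1 ^ 2 = roundFidelitySq E U φ (r.1, j) := by
  have : Nonempty (Fin M) := ⟨r.2⟩
  obtain ⟨j, hj⟩ := exists_eq_ciSup_of_finite (f := fun j : Fin M =>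
    fidelity (marginal (eveReply E U φ) (r.1, j)) (response U (φ r.1)))
  exact ⟨j, by rw [maxFidelity, ← hj, roundFidelitySq]⟩

theorem half_pow_le_productBound : (1 / 2 : ℝ) ^ (N * M) ≤ productBound E U φ := by
  rw [productBound_eq_prod]
  calc (1 / 2 : ℝ) ^ (N * M) = ∏ _r : Fin N × Fin M, (1 / 2 : ℝ) := by simp
    _ ≤ _ := Finset.prod_le_prod (fun _ _ => by norm_num) fun r _ => by
      linarith [sq_nonneg (maxFidelity E U φ r.1)]

theorem productBound_le :
    productBound E U φ ≤ (1 / 2) ^ (N * M) + ∑ r, roundFidelitySq E U φ r := by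
  rw [productBound_eq_prod]
  refine (prod_half_add_half_le _ (fun r => ⟨sq_nonneg _, ?_⟩) (fun r => ?_)
    (sum_roundFidelitySq_nonneg E U φ)).trans_eq (by simp) <;>
  obtain ⟨j, hj⟩ := exists_maxFidelity_sq_eq E U φ r <;> rw [hj]
  · exact E.fidelity_marginal_reply_sq_le_one _ _ _ (sum_norm_sq_response _ _)
  · exact Finset.single_le_sum (fun q _ => roundFidelitySq_nonneg E U φ q) (Finset.mem_univ _)

/-- Without entanglement the SWAP tests accept independently of each other. -/
theorem accept_le_productBound (h : Unentangled (eveReply E U φ)) :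
    accept E U φ ≤ productBound E U φ := by
  rw [accept, allSwapAccept_of_unentangled h fun _ => sum_norm_sq_response _ _,
    productBound_eq_prod]
  refine Finset.prod_le_prod (fun r _ => ?_) fun r _ => ?_
  · linarith [roundFidelitySq_nonneg E U φ r, roundFidelitySq.eq_1 E U φ r]
  · linarith [roundFidelitySq_le_maxFidelity_sq E U φ r, roundFidelitySq.eq_1 E U φ r]

end Bounds

section Means

variable {l N M : ℕ} (P : UnitaryQPUF) (E : Adversary l (Fin N × Fin M))

theorem isUnitBounded_roundFidelitySq (r : Fin N × Fin M) :
    IsUnitBounded fun p : Matrix.unitaryGroup (Str l) ℂ × (Fin N → PureState l) =>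
      roundFidelitySq E p.1 p.2 r :=
  E.isUnitBounded_fidelity_sq measurable_fst
    (fun q => (measurable_pi_apply q.1).comp measurable_snd)
    ((measurable_pi_apply r.1).comp measurable_snd) r

theorem measurable_accept :
    Measurable fun p : Matrix.unitaryGroup (Str l) ℂ × (Fin N → PureState l) =>
      accept E p.1 p.2 := by
  have h1 : ∀ x y, Measurable fun p : Matrix.unitaryGroup (Str l) ℂ × (Fin N → PureState l) =>
      eveReply E p.1 p.2 x y := fun x y => E.measurable_reply measurable_fst
    (fun q => (measurable_pi_apply q.1).comp measurable_snd) x y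
  have h2 : ∀ i s, Measurable fun p : Matrix.unitaryGroup (Str l) ℂ × (Fin N → PureState l) =>
      response p.1 (p.2 i) s := fun i s =>
    measurable_response measurable_fst ((measurable_pi_apply i).comp measurable_snd) s
  refine Complex.measurable_re.comp ?_
  simp only [Matrix.trace, Matrix.diag_apply, Matrix.mul_apply, Matrix.of_apply]
  refine Finset.measurable_sum _ fun x _ => Finset.measurable_sum _ fun y _ => ?_
  refine ((h1 _ _).mul (Finset.measurable_prod _ fun r _ => ?_)).mul measurable_const
  exact (h2 _ _).mul (continuous_star.measurable.comp (h2 _ _))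

theorem measurable_productBound :
    Measurable fun p : Matrix.unitaryGroup (Str l) ℂ × (Fin N → PureState l) =>
      productBound E p.1 p.2 := by
  refine Finset.measurable_prod _ fun i _ => Measurable.pow_const ?_ _
  refine measurable_const.add (Measurable.div_const (Measurable.pow_const ?_ _) _)
  exact Measurable.iSup fun j => E.measurable_fidelity measurable_fst
    (fun q => (measurable_pi_apply q.1).comp measurable_snd)
    (measurable_response measurable_fst ((measurable_pi_apply i).comp measurable_snd)) (i, j)

/-- The sum over all rounds of the protocol of the mean squared fidelities. -/
noncomputable def UnitaryQPUF.totalFidelitySq : ℝ :=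
  ∑ r, ∫ p, roundFidelitySq E p.1 p.2 r ∂P.gameLaw l N

theorem UnitaryQPUF.totalFidelitySq_nonneg : 0 ≤ P.totalFidelitySq E :=
  Finset.sum_nonneg fun r _ => ((isUnitBounded_roundFidelitySq E r).integral_mem _).1

theorem integrable_half_pow_add_sum : Integrable (fun p =>
    (1 / 2 : ℝ) ^ (N * M) + ∑ r, roundFidelitySq E p.1 p.2 r) (P.gameLaw l N) :=
  (integrable_const _).add
    (integrable_finsetSum _ fun r _ => (isUnitBounded_roundFidelitySq E r).integrable _)

theorem integral_half_pow_add_sum :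
    ∫ p, ((1 / 2 : ℝ) ^ (N * M) + ∑ r, roundFidelitySq E p.1 p.2 r) ∂P.gameLaw l N =
      (1 / 2) ^ (N * M) + P.totalFidelitySq E := by
  have h := fun r => (isUnitBounded_roundFidelitySq E r).integrable (P.gameLaw l N)
  rw [integral_add (integrable_const _) (integrable_finsetSum _ fun r _ => h r),
    integral_finsetSum _ fun r _ => h r]
  simp [UnitaryQPUF.totalFidelitySq]

theorem UnitaryQPUF.acceptProb_nonneg : 0 ≤ P.acceptProb E :=
  integral_nonneg fun _ => accept_nonneg E _ _

theorem UnitaryQPUF.acceptProb_le :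
    P.acceptProb E ≤ (1 / 2) ^ (N * M) + P.totalFidelitySq E := by
  rw [← integral_half_pow_add_sum]
  refine integral_mono ((integrable_half_pow_add_sum P E).mono'
    (measurable_accept E).aestronglyMeasurable (Filter.Eventually.of_forall fun p => ?_))
    (integrable_half_pow_add_sum P E) fun p => accept_le E _ _
  rw [Real.norm_of_nonneg (accept_nonneg E _ _)]
  exact accept_le E _ _

theorem integrable_productBound :
    Integrable (fun p => productBound E p.1 p.2) (P.gameLaw l N) := by
  refine (integrable_half_pow_add_sum P E).mono'
    (measurable_productBound E).aestronglyMeasurable (Filter.Eventually.of_forall fun p => ?_)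
  rw [Real.norm_of_nonneg ((by positivity : (0 : ℝ) ≤ _).trans (half_pow_le_productBound E _ _))]
  exact productBound_le E _ _

theorem UnitaryQPUF.meanProductBound_le :
    P.meanProductBound E ≤ (1 / 2) ^ (N * M) + P.totalFidelitySq E := by
  rw [← integral_half_pow_add_sum]
  exact integral_mono (integrable_productBound P E) (integrable_half_pow_add_sum P E)
    fun p => productBound_le E _ _

theorem UnitaryQPUF.half_pow_le_meanProductBound :
    (1 / 2 : ℝ) ^ (N * M) ≤ P.meanProductBound E := by
  calc (1 / 2 : ℝ) ^ (N * M) = ∫ _, (1 / 2 : ℝ) ^ (N * M) ∂P.gameLaw l N := by simp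
    _ ≤ _ := integral_mono (integrable_const _) (integrable_productBound P E)
      fun p => half_pow_le_productBound E _ _

/-- One single-round adversary is, up to `ε`, as good as the best of those that use the circuits
of `E`. -/
theorem UnitaryQPUF.exists_forgeMean_single_le {ε : ℝ} (hε : 0 < ε) :
    ∃ A : Adversary l Unit, A.size ≤ E.size + N * M * l + 3 * l ∧
      ∀ r s η, P.forgeMean (E.single r s η) ≤ P.forgeMean A + ε := by
  set ι := (Fin N × Fin M) × (Fin N × Fin M) × (Fin N × Fin M → PureState l)
  rcases isEmpty_or_nonempty ι with h | h
  · refine ⟨⟨0, fun _ => 1, by simp, [], []⟩, Nat.zero_le _, fun r s η => ?_⟩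
    exact (h.false (r, s, η)).elim
  · let f : ι → ℝ := fun x => P.forgeMean (E.single x.1 x.2.1 x.2.2)
    have hb : BddAbove (Set.range f) := ⟨1, by
      rintro _ ⟨x, rfl⟩
      exact P.forgeMean_le_one _⟩
    obtain ⟨x, hx⟩ := exists_lt_of_lt_ciSup (f := f) (sub_lt_self (⨆ x, f x) hε)
    refine ⟨E.single x.1 x.2.1 x.2.2, ?_, fun r s η => ?_⟩
    · simpa using E.size_single_le x.1 x.2.1 x.2.2
    · have h1 : f (r, s, η) ≤ ⨆ x, f x := le_ciSup hb (r, s, η)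
      change f (r, s, η) ≤ f x + ε
      linarith

theorem UnitaryQPUF.totalFidelitySq_le {B : ℝ}
    (hB : ∀ r s η, P.forgeMean (E.single r s η) ≤ B) :
    P.totalFidelitySq E ≤ (N * M : ℕ) * ((1 / 2 : ℝ) ^ l + M * (M * B)) := by
  calc P.totalFidelitySq E
      ≤ ∑ _r : Fin N × Fin M, ((1 / 2 : ℝ) ^ l + M * (M * B)) :=
        Finset.sum_le_sum fun r _ => P.integral_fidelity_sq_le E r (hB r)
    _ = _ := by rw [Finset.sum_const, nsmul_eq_mul]; simp

end Means

/-! ### Negligible functions -/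

theorem PolyBounded.of_le {f g : ℕ → ℕ} (hg : PolyBounded g) (h : ∀ l, f l ≤ g l) :
    PolyBounded f :=
  hg.imp fun _ hp l => (h l).trans (hp l)

theorem polyBounded_id : PolyBounded fun l => l := ⟨Polynomial.X, fun l => by simp⟩

theorem PolyBounded.add {f g : ℕ → ℕ} (hf : PolyBounded f) (hg : PolyBounded g) :
    PolyBounded fun l => f l + g l := by
  obtain ⟨p, hp⟩ := hf
  obtain ⟨q, hq⟩ := hg
  exact ⟨p + q, fun l => by simpa using add_le_add (hp l) (hq l)⟩

theorem PolyBounded.mul {f g : ℕ → ℕ} (hf : PolyBounded f) (hg : PolyBounded g) :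
    PolyBounded fun l => f l * g l := by
  obtain ⟨p, hp⟩ := hf
  obtain ⟨q, hq⟩ := hg
  exact ⟨p * q, fun l => by simpa using Nat.mul_le_mul (hp l) (hq l)⟩

theorem Negligible.add {f g : ℕ → ℝ} (hf : Negligible f) (hg : Negligible g) :
    Negligible fun l => f l + g l :=
  Asymptotics.SuperpolynomialDecay.add hf hg

theorem Negligible.of_le {f g : ℕ → ℝ} (hg : Negligible g) (h0 : ∀ l, 0 ≤ f l)
    (h : ∀ l, f l ≤ g l) : Negligible f :=
  Asymptotics.SuperpolynomialDecay.trans_abs_le hg fun l =>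
    abs_le_abs_of_nonneg (h0 l) (h l)

theorem Negligible.polyBounded_mul {f : ℕ → ℝ} (hf : Negligible f) (h0 : ∀ l, 0 ≤ f l)
    {n : ℕ → ℕ} (hn : PolyBounded n) : Negligible fun l => n l * f l := by
  obtain ⟨p, hp⟩ := hn
  refine Negligible.of_le (Asymptotics.SuperpolynomialDecay.polynomial_mul hf
    (p.map (Nat.castRingHom ℝ))) (fun l => mul_nonneg (Nat.cast_nonneg _) (h0 l)) fun l => ?_
  rw [Polynomial.eval_natCast_map, eq_natCast]
  exact mul_le_mul_of_nonneg_right (by exact_mod_cast hp l) (h0 l)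

theorem negligible_half_pow : Negligible fun l => (1 / 2 : ℝ) ^ l := fun k =>
  tendsto_pow_const_mul_const_pow_of_lt_one k (by norm_num) (by norm_num)

/-- Selective unforgeability bounds the mean of the squared fidelity, too. -/
theorem UnitaryQPUF.SelectivelyUnforgeable.negligible_forgeMean {P : UnitaryQPUF}
    (hP : P.SelectivelyUnforgeable) {A : ∀ l, Adversary l Unit} (hA : QPT A) :
    Negligible fun l => P.forgeMean (A l) := by
  refine (Asymptotics.superpolynomialDecay_iff_abs_isBoundedUnder _
    tendsto_natCast_atTop_atTop).2 fun z => ?_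
  -- against `l ^ z`, the threshold `1 / (l + 1) ^ z` for the fidelity is good enough
  obtain ⟨b, hb⟩ := (hP A hA z z).isBoundedUnder_le
  refine ⟨1 + b, ?_⟩
  rw [Filter.eventually_map] at hb ⊢
  filter_upwards [hb] with l hl
  have hl0 : (0 : ℝ) ≤ l := Nat.cast_nonneg l
  rw [abs_of_nonneg (mul_nonneg (pow_nonneg hl0 z) (P.forgeMean_nonneg _))]
  have h1 : (l : ℝ) ^ z * (1 / ((l : ℝ) + 1) ^ z) ^ 2 ≤ 1 := by
    have h2 : (l : ℝ) ^ z ≤ ((l : ℝ) + 1) ^ z := pow_le_pow_left₀ hl0 (by linarith) z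
    have h3 : (1 : ℝ) ≤ ((l : ℝ) + 1) ^ z := one_le_pow₀ (by linarith)
    rw [div_pow, one_pow, mul_one_div, div_le_one (by positivity)]
    nlinarith
  calc (l : ℝ) ^ z * P.forgeMean (A l)
      ≤ (l : ℝ) ^ z * ((1 / ((l : ℝ) + 1) ^ z) ^ 2 +
          P.forgeProb (A l) (1 / ((l : ℝ) + 1) ^ z)) :=
        mul_le_mul_of_nonneg_left (P.forgeMean_le _) (pow_nonneg hl0 z)
    _ ≤ 1 + b := by
        rw [mul_add]
        exact add_le_add h1 hl

/-- Against a selectively unforgeable qPUF, the squared fidelities of all rounds of the protocol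
are negligible in the mean, and so is their sum. -/
theorem UnitaryQPUF.SelectivelyUnforgeable.negligible_totalFidelitySq {P : UnitaryQPUF}
    (hP : P.SelectivelyUnforgeable) {N M : ℕ → ℕ} (hN : PolyBounded N) (hM : PolyBounded M)
    {Eve : ∀ l, Adversary l (Fin (N l) × Fin (M l))} (hEve : QPT Eve) :
    Negligible fun l => P.totalFidelitySq (Eve l) := by
  -- for every `l`, a nearly optimal single-round adversary; no uniformity in `l` is needed, as its
  -- circuits and its quantum advice may depend on `l` in an arbitrary way
  choose A hA hle using fun l => P.exists_forgeMean_single_le (Eve l)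
    (ε := (1 / 2 : ℝ) ^ l) (by positivity)
  have hQ : QPT A := by
    refine PolyBounded.of_le ?_ hA
    exact (hEve.add ((hN.mul hM).mul polyBounded_id)).add
      (PolyBounded.mul ⟨3, fun l => by simp⟩ polyBounded_id)
  have h1 : Negligible fun l => P.forgeMean (A l) + (1 / 2 : ℝ) ^ l :=
    (hP.negligible_forgeMean hQ).add negligible_half_pow
  have p1 : ∀ l, 0 ≤ P.forgeMean (A l) + (1 / 2 : ℝ) ^ l := fun l =>
    add_nonneg (P.forgeMean_nonneg _) (by positivity)
  have h2 := h1.polyBounded_mul p1 hM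
  have p2 := fun l => mul_nonneg (Nat.cast_nonneg (M l)) (p1 l)
  have h3 := negligible_half_pow.add (h2.polyBounded_mul p2 hM)
  have p3 : ∀ l, 0 ≤ (1 / 2 : ℝ) ^ l +
      M l * (M l * (P.forgeMean (A l) + (1 / 2 : ℝ) ^ l)) := fun l =>
    add_nonneg (by positivity) (mul_nonneg (Nat.cast_nonneg (M l)) (p2 l))
  exact (h3.polyBounded_mul p3 (hN.mul hM)).of_le (fun l => P.totalFidelitySq_nonneg _)
    fun l => P.totalFidelitySq_le (Eve l) (hle l)

end SwapId

open SwapId in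
theorem mainTheorem1 (P : UnitaryQPUF) (hP : P.SelectivelyUnforgeable)
    (N M : ℕ → ℕ) (hN : PolyBounded N) (hM : PolyBounded M)
    (Eve : ∀ l, Adversary l (Fin (N l) × Fin (M l))) (hEve : QPT Eve) :
    (∃ ν : ℕ → ℝ, Negligible ν ∧ ∀ l,
      P.acceptProb (Eve l) ≤ P.meanProductBound (Eve l) + ν l ∧
      P.meanProductBound (Eve l) ≤ (1 / 2 : ℝ) ^ (N l * M l) + ν l) ∧
    (PolyBounded (fun l => 2 ^ (N l * M l)) →
      (fun l => P.acceptProb (Eve l)) =O[Filter.atTop] (fun l => (1 / 2 : ℝ) ^ (N l * M l)) ∧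
      ∃ δ : ℕ → ℝ, Negligible δ ∧ ∀ l,
        P.acceptProb (Eve l) ≤ ∏ _i : Fin (N l), (1 / 2 + δ l / 2) ^ M l) ∧
    (Negligible (fun l => (1 / 2 : ℝ) ^ (N l * M l)) →
      Negligible fun l => P.acceptProb (Eve l)) ∧
    (∀ l (U : Matrix.unitaryGroup (Str l) ℂ) (φ : Fin (N l) → PureState l),
      Unentangled (eveReply (Eve l) U φ) →
      accept (Eve l) U φ ≤ productBound (Eve l) U φ) := by
  have hτ := hP.negligible_totalFidelitySq hN hM hEve
  have hτ0 : ∀ l, 0 ≤ P.totalFidelitySq (Eve l) := fun l => P.totalFidelitySq_nonneg _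
  refine ⟨⟨_, hτ, fun l => ⟨?_, P.meanProductBound_le _⟩⟩, fun h2 => ?_, fun h => ?_,
    fun l U φ h => accept_le_productBound _ U φ h⟩
  · linarith [P.acceptProb_le (Eve l), P.half_pow_le_meanProductBound (Eve l)]
  · have hδ : Negligible fun l => ((2 ^ (N l * M l) : ℕ) : ℝ) * P.totalFidelitySq (Eve l) :=
      hτ.polyBounded_mul hτ0 h2
    have hle : ∀ l, P.acceptProb (Eve l) ≤ (1 / 2 : ℝ) ^ (N l * M l) *
        (1 + ((2 ^ (N l * M l) : ℕ) : ℝ) * P.totalFidelitySq (Eve l)) := fun l => by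
      refine (P.acceptProb_le (Eve l)).trans_eq ?_
      rw [mul_add, mul_one, ← mul_assoc, Nat.cast_pow, ← mul_pow]
      norm_num
    refine ⟨?_, _, hδ, fun l => ?_⟩
    · -- the factor `1 + 2 ^ (N * M) * totalFidelitySq` is at most `2` eventually
      refine Asymptotics.IsBigO.of_bound 2 ?_
      filter_upwards [(hδ 0).eventually_le_const (zero_lt_one' ℝ)] with l hl
      rw [pow_zero, one_mul] at hl
      rw [Real.norm_of_nonneg (P.acceptProb_nonneg _), Real.norm_of_nonneg (by positivity),
        mul_comm]
      exact (hle l).trans (mul_le_mul_of_nonneg_left (by linarith) (by positivity))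
    · refine (hle l).trans ?_
      rw [Finset.prod_const, Finset.card_univ, Fintype.card_fin, ← pow_mul, mul_comm (M l)]
      set n := N l * M l with hn
      set t := ((2 ^ n : ℕ) : ℝ) * P.totalFidelitySq (Eve l) with ht
      have ht0 : 0 ≤ t := mul_nonneg (Nat.cast_nonneg _) (hτ0 l)
      rw [show (1 / 2 + t / 2 : ℝ) = 1 / 2 * (1 + t) by ring, mul_pow]
      refine mul_le_mul_of_nonneg_left ?_ (by positivity)
      rcases Nat.eq_zero_or_pos n with h0 | h0
      · -- without rounds the sum of the fidelities is empty
        have hz : P.totalFidelitySq (Eve l) = 0 := by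
          have he : IsEmpty (Fin (N l) × Fin (M l)) := by
            rw [← Fintype.card_eq_zero_iff]
            simpa [hn] using h0
          simp [UnitaryQPUF.totalFidelitySq]
        simp [ht, hz]
      · exact le_self_pow₀ (by linarith) h0.ne'
  · exact (h.add hτ).of_le (fun l => P.acceptProb_nonneg _) fun l => P.acceptProb_le _
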